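/- Let $N\ge 2$ be an integer, let $B$ be the open unit ball of $\mathbb R^N$ centred at the origin, and let $\omega_N$ be its Lebesgue measure. Let $M>0$ and $0<\varepsilon<1$ be such that $\varepsilon\,\omega_N(1-\varepsilon)^N<M$, and put $$\tilde\rho_\varepsilon=\frac{M-\varepsilon\omega_N(1-\varepsilon)^N}{\omega_N\left(1-(1-\varepsilon)^N\right)}>0,\qquad \rho_\varepsilon(x)=\begin{cases}\varepsilon,&|x|\le 1-\varepsilon,\\ \tilde\rho_\varepsilon,&1-\varepsilon<|x|<1.\end{cases}$$ A real number $\lambda$ is called an eigenvalue of the Neumann problem $$-\Delta u=\lambda\rho_\varepsilon u\ \text{ in } B,\qquad \frac{\partial u}{\partial\nu}=0\ \text{ on }\partial B,$$ if there is a $u\in H^1(B)$, $u\neq 0$, such that $\int_B\nabla u\cdot\nabla v\,dx=\lambda\int_B\rho_\varepsilon uv\,dx$ for all $v\in H^1(B)$. For $l\in\mathbb N=\{0,1,2,\dots\}$ let $\nu_l=l+\frac N2-1$, let $J_{\nu_l}$ and $Y_{\nu_l}$ denote the Bessel functions of the first and of the second kind of order $\nu_l$, and for $\lambda>0$ put $$a=\sqrt{\lambda\varepsilon}\,(1-\varepsilon),\qquad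 b=\sqrt{\lambda\tilde\rho_\varepsilon}\,(1-\varepsilon).$$ Then a real number $\lambda$ is a nonzero eigenvalue of the Neumann problem if and only if $\lambda>0$ and, for some $l\in\mathbb N$, $$\left(1-\frac N2\right)P_1(a,b)+\frac{b}{1-\varepsilon}\,P_2(a,b)=0,$$ where $$\begin{aligned} P_1(a,b)&=J_{\nu_l}(a)\left(Y_{\nu_l}'(b)J_{\nu_l}\!\left(\tfrac{b}{1-\varepsilon}\right)-J_{\nu_l}'(b)Y_{\nu_l}\!\left(\tfrac{b}{1-\varepsilon}\right)\right)+\frac ab J_{\nu_l}'(a)\left(J_{\nu_l}(b)Y_{\nu_l}\!\left(\tfrac{b}{1-\varepsilon}\right)-Y_{\nu_l}(b)J_{\nu_l}\!\left(\tfrac{b}{1-\varepsilon}\right)\right),\\ P_2(a,b)&=J_{\nu_l}(a)\left(Y_{\nu_l}'(b)J_{\nu_l}'\!\left(\tfrac{b}{1-\varepsilon}\right)-J_{\nu_l}'(b)Y_{\nu_l}'\!\left(\tfrac{b}{1-\varepsilon}\right)\right)+\frac ab J_{\nu_l}'(a)\left(J_{\nu_l}(b)Y_{\nu_l}'\!\left(\tfrac{b}{1-\varepsilon}\right)-Y_{\nu_l}(b)J_{\nu_l}'\!\left(\tfrac{b}{1-\varepsilon}\right)\right).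 \end{aligned}$$ -/

import Mathlib

open MeasureTheory
open scoped ContDiff

noncomputable section

/-- The open unit ball `B` of `ℝ^N`, centred at the origin. -/
def unitBall (N : ℕ) : Set (EuclideanSpace ℝ (Fin N)) := Metric.ball 0 1

/-- `ω_N`, the Lebesgue measure of the unit ball of `ℝ^N`. -/
def ballVolume (N : ℕ) : ℝ := volume.real (unitBall N)

/-- The value of the mass density in the boundary layer `1 - ε < |x| < 1`. -/
def rhoTilde (N : ℕ) (M ε : ℝ) : ℝ :=
  (M - ε * ballVolume N * (1 - ε) ^ N) / (ballVolume N * (1 - (1 - ε) ^ N))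

/-- The mass density `ρ_ε`. -/
def density (N : ℕ) (M ε : ℝ) (x : EuclideanSpace ℝ (Fin N)) : ℝ :=
  if ‖x‖ ≤ 1 - ε then ε else rhoTilde N M ε

/-- `φ ∈ C_c^∞(Ω)`. -/
structure IsTestFunctionOn {N : ℕ} (Ω : Set (EuclideanSpace ℝ (Fin N)))
    (φ : EuclideanSpace ℝ (Fin N) → ℝ) : Prop where
  smooth : ContDiff ℝ ∞ φ
  hasCompactSupport : HasCompactSupport φ
  support_subset : tsupport φ ⊆ Ω

/-- `u` belongs to the Sobolev space `H¹(Ω)` and `g` is its weak gradient: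
`u` and `g` are square integrable on `Ω`, and
`∫_Ω u ∂_i φ = - ∫_Ω g_i φ` for all `φ ∈ C_c^∞(Ω)` and all `i`. -/
structure HasH1Gradient {N : ℕ} (Ω : Set (EuclideanSpace ℝ (Fin N)))
    (u : EuclideanSpace ℝ (Fin N) → ℝ)
    (g : EuclideanSpace ℝ (Fin N) → EuclideanSpace ℝ (Fin N)) : Prop where
  memLp : MemLp u 2 (volume.restrict Ω)
  memLp_grad : MemLp g 2 (volume.restrict Ω)
  integral_eq : ∀ φ : EuclideanSpace ℝ (Fin N) → ℝ, IsTestFunctionOn Ω φ → ∀ i : Fin N,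
    ∫ x in Ω, u x * fderiv ℝ φ x (EuclideanSpace.single i 1) = -∫ x in Ω, g x i * φ x

/-- `u` is an eigenfunction with eigenvalue `lam` of the Neumann problem
`-Δu = lam ρ u` in `Ω`, `∂u/∂ν = 0` on `∂Ω`, in the usual weak sense: `u ∈ H¹(Ω)`, `u ≠ 0`, and
`∫_Ω ∇u · ∇v = lam ∫_Ω ρ u v` for all `v ∈ H¹(Ω)`. -/
def IsNeumannEigenfunction {N : ℕ} (Ω : Set (EuclideanSpace ℝ (Fin N)))
    (ρ : EuclideanSpace ℝ (Fin N) → ℝ) (lam : ℝ) (u : EuclideanSpace ℝ (Fin N) → ℝ) : Prop :=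
  (¬ ∀ᵐ x ∂(volume.restrict Ω), u x = 0) ∧
  ∃ g : EuclideanSpace ℝ (Fin N) → EuclideanSpace ℝ (Fin N), HasH1Gradient Ω u g ∧
    ∀ (v : EuclideanSpace ℝ (Fin N) → ℝ)
      (h : EuclideanSpace ℝ (Fin N) → EuclideanSpace ℝ (Fin N)), HasH1Gradient Ω v h →
        ∫ x in Ω, inner ℝ (g x) (h x) = lam * ∫ x in Ω, ρ x * u x * v x

/-- `lam` is an eigenvalue of the Neumann problem on the unit ball with density `ρ_ε`. -/
def IsNeumannEigenvalue (N : ℕ) (M ε lam : ℝ) : Prop :=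
  ∃ u : EuclideanSpace ℝ (Fin N) → ℝ,
    IsNeumannEigenfunction (unitBall N) (density N M ε) lam u

/-- The Bessel function of the first kind `J_ν(z)` for real order `ν` and `z > 0`:
`J_ν(z) = ∑_k (-1)^k / (k! Γ(k + ν + 1)) (z/2)^(2k + ν)`.
At the poles of the Gamma function, `1 / Γ` is `0` (in Mathlib as in the series). -/
def besselJ (ν z : ℝ) : ℝ :=
  ∑' k : ℕ, (-1 : ℝ) ^ k / ((k.factorial : ℝ) * Real.Gamma ((k : ℝ) + ν + 1))
    * (z / 2) ^ (2 * (k : ℝ) + ν)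

/-- The digamma function at positive integers: `ψ(m + 1) = -γ + ∑_{j=1}^m 1/j`. -/
def digammaSucc (m : ℕ) : ℝ := -Real.eulerMascheroniConstant + (harmonic m : ℝ)

/-- The Bessel function of the second kind `Y_n(z)`, of integer order `n ≥ 0`, for `z > 0`:
`Y_n(z) = (2/π) log(z/2) J_n(z) - (1/π) ∑_{k<n} ((n-k-1)!/k!) (z/2)^(2k-n)
  - (1/π) ∑_k (ψ(k+1) + ψ(n+k+1)) (-1)^k / (k! (n+k)!) (z/2)^(2k+n)`. -/
def besselYNat (n : ℕ) (z : ℝ) : ℝ :=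
  2 / Real.pi * Real.log (z / 2) * besselJ (n : ℝ) z
    - 1 / Real.pi * ∑ k ∈ Finset.range n,
        ((n - k - 1).factorial : ℝ) / (k.factorial : ℝ) * (z / 2) ^ (2 * (k : ℤ) - (n : ℤ))
    - 1 / Real.pi * ∑' k : ℕ,
        (digammaSucc k + digammaSucc (n + k))
          * ((-1 : ℝ) ^ k / ((k.factorial : ℝ) * ((n + k).factorial : ℝ)))
          * (z / 2) ^ (2 * k + n)

open Classical in
/-- The Bessel function of the second kind `Y_ν(z)` for real order `ν ≥ 0` and `z > 0`. It is
`(J_ν(z) cos(νπ) - J_{-ν}(z)) / sin(νπ)` if `ν` is not an integer, and the limit of this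
expression, given by the classical series, if `ν` is an integer. -/
def besselY (ν z : ℝ) : ℝ :=
  if ν = (⌊ν⌋₊ : ℝ) then besselYNat ⌊ν⌋₊ z
  else (besselJ ν z * Real.cos (ν * Real.pi) - besselJ (-ν) z) / Real.sin (ν * Real.pi)

/-- The order `ν_l = l + N/2 - 1`. -/
def besselOrder (N l : ℕ) : ℝ := (l : ℝ) + (N : ℝ) / 2 - 1

/-- The quantity `a = √(λ ε) (1 - ε)`. -/
def aParam (ε lam : ℝ) : ℝ := Real.sqrt (lam * ε) * (1 - ε)

/-- The quantity `b = √(λ ρ̃_ε) (1 - ε)`. -/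
def bParam (N : ℕ) (M ε lam : ℝ) : ℝ := Real.sqrt (lam * rhoTilde N M ε) * (1 - ε)

/-- The cross product `P_1(a, b)` of Bessel functions of order `ν`. -/
def crossP1 (ν ε a b : ℝ) : ℝ :=
  besselJ ν a * (deriv (besselY ν) b * besselJ ν (b / (1 - ε))
      - deriv (besselJ ν) b * besselY ν (b / (1 - ε)))
    + a / b * deriv (besselJ ν) a * (besselJ ν b * besselY ν (b / (1 - ε))
      - besselY ν b * besselJ ν (b / (1 - ε)))

/-- The cross product `P_2(a, b)` of Bessel functions of order `ν`. -/
def crossP2 (ν ε a b : ℝ) : ℝ :=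
  besselJ ν a * (deriv (besselY ν) b * deriv (besselJ ν) (b / (1 - ε))
      - deriv (besselJ ν) b * deriv (besselY ν) (b / (1 - ε)))
    + a / b * deriv (besselJ ν) a * (besselJ ν b * deriv (besselY ν) (b / (1 - ε))
      - besselY ν b * deriv (besselJ ν) (b / (1 - ε)))

end

/-! For a homogeneous harmonic polynomial `H` of degree `l` and a function `f` of `s = |x|²`, the
Laplacian of `f(|x|²) H` is `(4 s f'' + 2 (N + 2l) f') H`. So `-Δ(f H) = λ ρ f H` becomes the radial
equation `s f'' + (l + N/2) f' + (λρ/4) f = 0`, with different constants `ρ` on the two sides of `s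
= (1-ε)²`. After scaling `s` this is Clifford's equation `z y'' + (ν + 1) y' + y = 0` with `ν =
ν_l`, whose solutions are `J_ν` and `Y_ν` stripped of the factor `(x/2)^ν` and written in `z =
x²/4`. The regular inner solution continues uniquely to a `C¹` function in the outer layer, and the
Neumann condition for `f(|x|²) H` says that the flux `2 f'(1) + l f(1)` is zero. Up to nonzero
factors this flux is the left-hand side of the cross-product equation (`cross_eq_zero_iff`,
`exists_isRadialSystem`).

If the flux vanishes for some `l`, then `f(|x|²) H`, with `H` the real part of `(x₁ + i x₂)^l`, is
an eigenfunction. This is checked against arbitrary `H¹` functions by Green's formula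
(`IsNeumannProfile.green`).

The converse is a duality argument that needs neither regularity of weak solutions nor separation of
variables. If the flux is nonzero for every `l`, then for all `l`, `j` and `H` there is `w = f(|x|²)
H` with `-Δw = ρ (λ w + |x|^{2j} H)` and Neumann boundary condition
(`IsRadialSystem.exists_inhomogeneous`). Pairing `w` with an eigenfunction `u` gives `∫ ρ u |x|^{2j}
H = 0`. The functions `|x|^{2j} H` span all polynomials (`eq_top_of_normSqPoly_pow_mul_mem`), and
polynomials are dense by Stone–Weierstrass, so `ρ u = 0` and hence `u = 0`, a contradiction.
Positivity of a nonzero eigenvalue comes from testing with `u` itself. -/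

noncomputable section

/-! ### Entire power series on the real line. -/

/-- The power series with coefficients `a` converges on the whole real line. -/
def IsEntireSeries (a : ℕ → ℝ) : Prop := ∀ r : ℝ, Summable fun k => |a k * r ^ k|

/-- The sum of the power series with coefficients `a`. -/
def powerSum (a : ℕ → ℝ) (z : ℝ) : ℝ := ∑' k, a k * z ^ k

/-- The coefficients of the derivative of a power series. -/
def derivCoeff (a : ℕ → ℝ) (k : ℕ) : ℝ := ((k : ℝ) + 1) * a (k + 1)

theorem IsEntireSeries.summable {a : ℕ → ℝ} (ha : IsEntireSeries a) (z : ℝ) :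
    Summable fun k => a k * z ^ k := (ha z).of_abs

/-- The factor `2^k` is absorbed by evaluating the given series at `2r`; it leaves room for
coefficients multiplied by a factor linear in `k`, since `k + 1 ≤ 2^k`. -/
theorem IsEntireSeries.of_le {a b : ℕ → ℝ} (ha : IsEntireSeries a) (A : ℝ)
    (h : ∀ k, |b k| ≤ A * (2 ^ k * |a k|)) : IsEntireSeries b := by
  intro r
  refine Summable.of_nonneg_of_le (fun k => abs_nonneg _) (fun k => ?_) ((ha (2 * r)).mul_left A)
  rw [abs_mul, abs_mul, mul_pow, abs_mul, abs_of_pos (by positivity : (0 : ℝ) < 2 ^ k)]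
  calc |b k| * |r ^ k| ≤ A * (2 ^ k * |a k|) * |r ^ k| := by gcongr; exact h k
    _ = _ := by ring

theorem IsEntireSeries.shift {a : ℕ → ℝ} (ha : IsEntireSeries a) :
    IsEntireSeries fun k => a (k + 1) := by
  intro r
  have h := (summable_nat_add_iff 1).2 (ha (|r| + 1))
  refine Summable.of_nonneg_of_le (fun k => abs_nonneg _) (fun k => ?_) h
  rw [abs_mul, abs_mul, abs_pow, abs_pow, abs_of_nonneg (by positivity : 0 ≤ |r| + 1), pow_succ]
  gcongr
  calc |r| ^ k ≤ (|r| + 1) ^ k := by gcongr; linarith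
    _ ≤ _ := le_mul_of_one_le_right (by positivity) (by linarith [abs_nonneg r])

theorem natCast_add_one_le_two_pow (k : ℕ) : (k : ℝ) + 1 ≤ 2 ^ k := by
  exact_mod_cast Nat.lt_two_pow_self

theorem IsEntireSeries.derivCoeff {a : ℕ → ℝ} (ha : IsEntireSeries a) :
    IsEntireSeries (derivCoeff a) := by
  refine ha.shift.of_le 1 fun k => ?_
  rw [_root_.derivCoeff, abs_mul, abs_of_nonneg (by positivity), one_mul]
  gcongr
  exact natCast_add_one_le_two_pow k

theorem hasDerivAt_powerSum {a : ℕ → ℝ} (ha : IsEntireSeries a) (z : ℝ) :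
    HasDerivAt (powerSum a) (powerSum (derivCoeff a) z) z := by
  have key : HasDerivAt (fun w => ∑' k, a k * w ^ k) (∑' k, a k * (k * z ^ (k - 1))) z := by
    have hz : z ∈ Metric.ball (0 : ℝ) (|z| + 1) := by simp
    refine hasDerivAt_tsum_of_isPreconnected (g := fun k w => a k * w ^ k)
      (g' := fun k w => a k * (k * w ^ (k - 1))) (u := fun k => |a k * (k * (|z| + 1) ^ (k - 1))|)
      (t := Metric.ball 0 (|z| + 1)) ?_ Metric.isOpen_ball
      (convex_ball _ _).isPreconnected (fun k y _ => ?_) (fun k y hy => ?_) hz (ha.summable z) hz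
    · rw [← summable_nat_add_iff 1]
      refine (ha.derivCoeff (|z| + 1)).congr fun k => ?_
      simp only [derivCoeff, Nat.cast_add, Nat.cast_one, Nat.add_sub_cancel]
      congr 1
      ring
    · simpa using (hasDerivAt_pow k y).const_mul (a k)
    · rw [Real.norm_eq_abs, abs_mul, abs_mul, abs_mul, abs_mul, abs_pow, abs_pow]
      have : |y| ≤ abs (|z| + 1) := by
        rw [abs_of_nonneg (by positivity : 0 ≤ |z| + 1)]
        simpa using (mem_ball_zero_iff.1 hy).le
      gcongr
  have hs : Summable fun k => a k * ((k : ℝ) * z ^ (k - 1)) := by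
    rw [← summable_nat_add_iff 1]
    refine (ha.derivCoeff.summable z).congr fun k => ?_
    simp only [derivCoeff, Nat.cast_add, Nat.cast_one, Nat.add_sub_cancel]
    ring
  have hsum : powerSum (derivCoeff a) z = ∑' k, a k * (k * z ^ (k - 1)) := by
    rw [hs.tsum_eq_zero_add]
    simp only [powerSum, derivCoeff, Nat.cast_add, Nat.cast_one, Nat.add_sub_cancel, Nat.cast_zero,
      zero_mul, mul_zero, zero_add]
    exact tsum_congr fun k => by ring
  rw [hsum]
  exact key

theorem deriv_powerSum {a : ℕ → ℝ} (ha : IsEntireSeries a) :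
    deriv (powerSum a) = powerSum (derivCoeff a) :=
  funext fun z => (hasDerivAt_powerSum ha z).deriv

theorem contDiff_powerSum {a : ℕ → ℝ} (ha : IsEntireSeries a) : ContDiff ℝ ∞ (powerSum a) := by
  rw [contDiff_infty]
  intro n
  induction n generalizing a with
  | zero =>
    exact contDiff_zero.2 (continuous_iff_continuousAt.2 fun z =>
      (hasDerivAt_powerSum ha z).continuousAt)
  | succ n ih =>
    have : ((n + 1 : ℕ) : WithTop ℕ∞) = (n : WithTop ℕ∞) + 1 := by norm_cast
    rw [this, contDiff_succ_iff_deriv]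
    refine ⟨fun z => (hasDerivAt_powerSum ha z).differentiableAt, by simp, ?_⟩
    rw [deriv_powerSum ha]
    exact ih ha.derivCoeff

theorem powerSum_zero (a : ℕ → ℝ) : powerSum a 0 = a 0 := by
  rw [powerSum, tsum_eq_single 0 (fun k hk => by simp [hk])]
  simp

theorem mul_powerSum_shift {a : ℕ → ℝ} (ha : IsEntireSeries a) (z : ℝ) :
    z * powerSum (fun k => a (k + 1)) z = powerSum a z - a 0 := by
  rw [powerSum, powerSum, (ha.summable z).tsum_eq_zero_add, ← tsum_mul_left]
  simp only [pow_zero, mul_one, add_sub_cancel_left]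
  exact tsum_congr fun k => by ring

/-- The differential operator `z y'' + (ν + 1) y' + y` acting on a power series. -/
theorem powerSum_ode {a : ℕ → ℝ} (ha : IsEntireSeries a) (ν z : ℝ) :
    z * powerSum (derivCoeff (derivCoeff a)) z + (ν + 1) * powerSum (derivCoeff a) z + powerSum a z
      = powerSum (fun k => ((k : ℝ) + 1) * (k + 1 + ν) * a (k + 1) + a k) z := by
  have hk : IsEntireSeries fun k => (k : ℝ) * derivCoeff a k := by
    refine ha.derivCoeff.of_le 1 fun k => ?_
    rw [abs_mul, one_mul, abs_of_nonneg (by positivity)]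
    gcongr
    linarith [natCast_add_one_le_two_pow k]
  have h1 : z * powerSum (derivCoeff (derivCoeff a)) z
      = powerSum (fun k => (k : ℝ) * derivCoeff a k) z := by
    have := mul_powerSum_shift hk z
    simp only [Nat.cast_zero, zero_mul, sub_zero] at this
    rw [← this]
    congr 2
    ext k
    rw [derivCoeff]
    push_cast
    ring
  rw [h1, powerSum, powerSum, powerSum, powerSum, ← tsum_mul_left,
    ← (hk.summable z).tsum_add ((ha.derivCoeff.summable z).mul_left _),
    ← ((hk.summable z).add ((ha.derivCoeff.summable z).mul_left _)).tsum_add (ha.summable z)]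
  refine tsum_congr fun k => ?_
  rw [derivCoeff]
  ring

/-- Ratio test: the factor `(k + 1)(k + 1 + ν)` eventually exceeds `2|r|`. -/
theorem isEntireSeries_of_recurrence {a : ℕ → ℝ} {ν : ℝ}
    (h : ∀ k : ℕ, ((k : ℝ) + 1) * (k + 1 + ν) * a (k + 1) = -a k) : IsEntireSeries a := by
  intro r
  refine summable_of_ratio_norm_eventually_le (r := 1 / 2) (by norm_num) ?_
  obtain ⟨K, hK⟩ := exists_nat_ge (2 * |r| + |ν|)
  filter_upwards [Filter.eventually_ge_atTop K] with k hk
  have hk' : (K : ℝ) ≤ k := by exact_mod_cast hk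
  have h1 : 2 * |r| ≤ ((k : ℝ) + 1) * (k + 1 + ν) := by
    have : 2 * |r| + 1 ≤ k + 1 + ν := by linarith [neg_abs_le ν]
    nlinarith [abs_nonneg r, Nat.cast_nonneg (α := ℝ) k]
  have h2 : |a k| = ((k : ℝ) + 1) * (k + 1 + ν) * |a (k + 1)| := by
    rw [← abs_neg, ← h k, abs_mul, abs_of_nonneg (by linarith [abs_nonneg r])]
  rw [norm_abs_eq_norm, norm_abs_eq_norm, norm_mul, norm_mul, Real.norm_eq_abs, Real.norm_eq_abs,
    Real.norm_eq_abs, Real.norm_eq_abs, h2, pow_succ, abs_mul]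
  have h3 : 0 ≤ |a (k + 1)| * |r ^ k| := by positivity
  nlinarith [mul_le_mul_of_nonneg_right h1 h3]

/-! ### Bessel–Clifford functions, Clifford's equation and its Wronskian. -/

/-- The coefficients of the entire function `∑ (-z)^k / (k! Γ(k + ν + 1))`. -/
def besselCoeff (ν : ℝ) (k : ℕ) : ℝ :=
  (-1 : ℝ) ^ k / ((k.factorial : ℝ) * Real.Gamma ((k : ℝ) + ν + 1))

/-- The entire function `C_ν` with `J_ν(x) = (x/2)^ν C_ν(x²/4)` (the Bessel–Clifford function). -/
def besselClifford (ν : ℝ) : ℝ → ℝ := powerSum (besselCoeff ν)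

/-- The functional equation of `Γ`. The hypothesis keeps every `Γ(k + ν + 1)` away from the poles,
where division by the default value `0` would break the recurrence. -/
theorem besselCoeff_recurrence {ν : ℝ} (hν : ∀ k : ℕ, (k : ℝ) + ν + 1 ≠ 0) (k : ℕ) :
    ((k : ℝ) + 1) * (k + 1 + ν) * besselCoeff ν (k + 1) = -besselCoeff ν k := by
  have h1 : Real.Gamma (((k + 1 : ℕ) : ℝ) + ν + 1)
      = ((k : ℝ) + ν + 1) * Real.Gamma ((k : ℝ) + ν + 1) := by
    rw [← Real.Gamma_add_one (hν k)]
    push_cast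
    ring_nf
  rw [besselCoeff, besselCoeff, h1, Nat.factorial_succ, pow_succ]
  push_cast
  have h2 := hν k
  have h3 : Real.Gamma ((k : ℝ) + ν + 1) ≠ 0 := by
    refine Real.Gamma_ne_zero fun m hm => ?_
    have := hν (k + m)
    push_cast at this
    apply this
    linarith
  field_simp
  ring

theorem besselJ_eq {ν x : ℝ} (hx : 0 < x) :
    besselJ ν x = (x / 2) ^ ν * besselClifford ν (x ^ 2 / 4) := by
  rw [besselJ, besselClifford, powerSum, ← tsum_mul_left]
  refine tsum_congr fun k => ?_
  rw [Real.rpow_add (by positivity), Real.rpow_mul (by positivity), Real.rpow_natCast, besselCoeff,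
    Real.rpow_two, show x ^ 2 / 4 = (x / 2) ^ 2 by ring]
  ring

/-- `y` solves `z y'' + (ν + 1) y' + y = 0` on the positive half line, smoothly. -/
structure IsCliffordSolution (ν : ℝ) (y : ℝ → ℝ) : Prop where
  contDiffAt : ∀ z, 0 < z → ContDiffAt ℝ ∞ y z
  ode : ∀ z, 0 < z → z * deriv (deriv y) z + (ν + 1) * deriv y z + y z = 0

theorem IsCliffordSolution.hasDerivAt {ν z : ℝ} {y : ℝ → ℝ} (hy : IsCliffordSolution ν y)
    (hz : 0 < z) : HasDerivAt y (deriv y z) z :=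
  ((hy.contDiffAt z hz).differentiableAt (by simp)).hasDerivAt

theorem IsCliffordSolution.hasDerivAt_deriv {ν z : ℝ} {y : ℝ → ℝ} (hy : IsCliffordSolution ν y)
    (hz : 0 < z) : HasDerivAt (deriv y) (deriv (deriv y) z) z := by
  have : ContDiffAt ℝ 1 (deriv y) z :=
    (hy.contDiffAt z hz).derivWithin (m := 1) (by norm_cast)
  exact (this.differentiableAt (by simp)).hasDerivAt

theorem IsEntireSeries.besselCoeff {ν : ℝ} (hν : ∀ k : ℕ, (k : ℝ) + ν + 1 ≠ 0) :
    IsEntireSeries (besselCoeff ν) := isEntireSeries_of_recurrence (besselCoeff_recurrence hν)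

theorem besselClifford_ode {ν : ℝ} (hν : ∀ k : ℕ, (k : ℝ) + ν + 1 ≠ 0) (z : ℝ) :
    z * deriv (deriv (besselClifford ν)) z + (ν + 1) * deriv (besselClifford ν) z
      + besselClifford ν z = 0 := by
  have h := IsEntireSeries.besselCoeff hν
  rw [besselClifford, deriv_powerSum h, deriv_powerSum h.derivCoeff, powerSum_ode h]
  simp [besselCoeff_recurrence hν, powerSum]

theorem isCliffordSolution_besselClifford {ν : ℝ} (hν : ∀ k : ℕ, (k : ℝ) + ν + 1 ≠ 0) :
    IsCliffordSolution ν (besselClifford ν) where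
  contDiffAt _ _ := (contDiff_powerSum (IsEntireSeries.besselCoeff hν)).contDiffAt
  ode z _ := besselClifford_ode hν z

/-- Allows explicit formulas for the derivatives that are valid on the positive half line only, as
happens with `log z` and `z^(-ν)`. -/
theorem IsCliffordSolution.of_hasDerivAt {ν : ℝ} {y y' y'' : ℝ → ℝ}
    (hc : ∀ z, 0 < z → ContDiffAt ℝ ∞ y z)
    (h1 : ∀ z, 0 < z → HasDerivAt y (y' z) z) (h2 : ∀ z, 0 < z → HasDerivAt y' (y'' z) z)
    (h : ∀ z, 0 < z → z * y'' z + (ν + 1) * y' z + y z = 0) : IsCliffordSolution ν y where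
  contDiffAt := hc
  ode z hz := by
    have e : deriv y =ᶠ[nhds z] y' := by
      filter_upwards [lt_mem_nhds hz] with w hw using (h1 w hw).deriv
    rw [e.deriv_eq, (h2 z hz).deriv, (h1 z hz).deriv]
    exact h z hz

theorem IsCliffordSolution.linearCombination {ν : ℝ} {y₁ y₂ : ℝ → ℝ}
    (hy₁ : IsCliffordSolution ν y₁) (hy₂ : IsCliffordSolution ν y₂) (α β : ℝ) :
    IsCliffordSolution ν fun z => α * y₁ z + β * y₂ z := by
  refine .of_hasDerivAt
    (fun z hz => (contDiffAt_const.mul (hy₁.contDiffAt z hz)).add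
      (contDiffAt_const.mul (hy₂.contDiffAt z hz)))
    (fun z hz => ((hy₁.hasDerivAt hz).const_mul α).add ((hy₂.hasDerivAt hz).const_mul β))
    (fun z hz => ((hy₁.hasDerivAt_deriv hz).const_mul α).add
      ((hy₂.hasDerivAt_deriv hz).const_mul β)) fun z hz => ?_
  linear_combination α * hy₁.ode z hz + β * hy₂.ode z hz

/-- Abel's identity. -/
theorem IsCliffordSolution.wronskian_const {ν : ℝ} {y₁ y₂ : ℝ → ℝ}
    (hy₁ : IsCliffordSolution ν y₁) (hy₂ : IsCliffordSolution ν y₂) {z w : ℝ} (hz : 0 < z)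
    (hw : 0 < w) :
    z ^ (ν + 1) * (y₁ z * deriv y₂ z - deriv y₁ z * y₂ z)
      = w ^ (ν + 1) * (y₁ w * deriv y₂ w - deriv y₁ w * y₂ w) := by
  have hd : ∀ z ∈ Set.Ioi (0 : ℝ), HasDerivAt
      (fun z => z ^ (ν + 1) * (y₁ z * deriv y₂ z - deriv y₁ z * y₂ z)) 0 z := by
    intro z hz
    have hz : 0 < z := hz
    refine ((Real.hasDerivAt_rpow_const (p := ν + 1) (.inl hz.ne')).mul
      (((hy₁.hasDerivAt hz).mul (hy₂.hasDerivAt_deriv hz)).sub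
      ((hy₁.hasDerivAt_deriv hz).mul (hy₂.hasDerivAt hz)))).congr_deriv ?_
    have e : z ^ (ν + 1) = z * z ^ (ν + 1 - 1) := by
      rw [add_sub_cancel_right, Real.rpow_add_one hz.ne', mul_comm]
    rw [e]
    simp only [Pi.mul_apply, Pi.sub_apply]
    linear_combination z ^ (ν + 1 - 1) * (y₁ z * hy₂.ode z hz - y₂ z * hy₁.ode z hz)
  exact (convex_Ioi (0 : ℝ)).is_const_of_fderivWithin_eq_zero (𝕜 := ℝ)
    (fun z hz => (hd z hz).differentiableAt.differentiableWithinAt)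
    (fun z hz => by
      rw [fderivWithin_of_isOpen isOpen_Ioi hz, (hd z hz).hasFDerivAt.fderiv]
      simp) hz hw

/-- By Abel's identity the weighted Wronskian is constant on the positive half line. If it also
equals there a function `g` continuous at `0`, the constant is `g 0`, which can be read off from the
leading coefficients. -/
theorem IsCliffordSolution.wronskian_ne_zero {ν : ℝ} {y₁ y₂ g : ℝ → ℝ}
    (hy₁ : IsCliffordSolution ν y₁) (hy₂ : IsCliffordSolution ν y₂) (hg : ContinuousAt g 0)
    (hg0 : g 0 ≠ 0)
    (h : ∀ z, 0 < z → z ^ (ν + 1) * (y₁ z * deriv y₂ z - deriv y₁ z * y₂ z) = g z) {z : ℝ}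
    (hz : 0 < z) : y₁ z * deriv y₂ z - deriv y₁ z * y₂ z ≠ 0 := by
  intro h0
  have h1 : ∀ w, 0 < w → g w = 0 := fun w hw => by
    rw [← h w hw, hy₁.wronskian_const hy₂ hw hz, h0, mul_zero]
  have h2 : Filter.Tendsto g (nhdsWithin 0 (Set.Ioi 0)) (nhds 0) :=
    tendsto_const_nhds.congr' (by
      filter_upwards [self_mem_nhdsWithin] with w hw using (h1 w hw).symm)
  exact hg0 (tendsto_nhds_unique (hg.tendsto.mono_left nhdsWithin_le_nhds) h2)

theorem hasDerivAt_rpow_neg_mul {ν z K' : ℝ} {K : ℝ → ℝ} (hz : 0 < z) (hK : HasDerivAt K K' z) :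
    HasDerivAt (fun z => z ^ (-ν) * K z) (z ^ (-ν) * (K' - ν * K z / z)) z := by
  refine ((Real.hasDerivAt_rpow_const (p := -ν) (.inl hz.ne')).mul hK).congr_deriv ?_
  rw [Real.rpow_sub_one hz.ne']
  ring

theorem hasDerivAt_rpow_neg_mul_deriv {ν z K'' : ℝ} {K K' : ℝ → ℝ} (hz : 0 < z)
    (hK : HasDerivAt K (K' z) z) (hK' : HasDerivAt K' K'' z) :
    HasDerivAt (fun z => z ^ (-ν) * (K' z - ν * K z / z))
      (z ^ (-ν) * (K'' - 2 * ν * K' z / z + ν * (ν + 1) * K z / z ^ 2)) z := by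
  refine (hasDerivAt_rpow_neg_mul (ν := ν) hz
    (hK'.sub ((hK.const_mul ν).div (hasDerivAt_id' z) hz.ne'))).congr_deriv ?_
  simp only [Pi.sub_apply, Pi.div_apply]
  field_simp
  ring

theorem contDiffAt_rpow_neg_mul {ν z : ℝ} {K : ℝ → ℝ} (hz : 0 < z) (hK : ContDiffAt ℝ ∞ K z) :
    ContDiffAt ℝ ∞ (fun z => z ^ (-ν) * K z) z :=
  (Real.contDiffAt_rpow_const_of_ne hz.ne').mul hK

theorem besselClifford_zero (ν : ℝ) : besselClifford ν 0 = (Real.Gamma (ν + 1))⁻¹ := by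
  simp [besselClifford, powerSum_zero, besselCoeff]

theorem hasDerivAt_besselClifford {ν : ℝ} (hν : ∀ k : ℕ, (k : ℝ) + ν + 1 ≠ 0) (z : ℝ) :
    HasDerivAt (besselClifford ν) (deriv (besselClifford ν) z) z :=
  ((contDiff_powerSum (IsEntireSeries.besselCoeff hν)).differentiable (by simp) z).hasDerivAt

theorem hasDerivAt_deriv_besselClifford {ν : ℝ} (hν : ∀ k : ℕ, (k : ℝ) + ν + 1 ≠ 0) (z : ℝ) :
    HasDerivAt (deriv (besselClifford ν)) (deriv (deriv (besselClifford ν)) z) z := by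
  have h := IsEntireSeries.besselCoeff hν
  rw [besselClifford, deriv_powerSum h]
  exact ((contDiff_powerSum h.derivCoeff).differentiable (by simp) z).hasDerivAt

theorem continuous_deriv_besselClifford {ν : ℝ} (hν : ∀ k : ℕ, (k : ℝ) + ν + 1 ≠ 0) :
    Continuous (deriv (besselClifford ν)) :=
  continuous_iff_continuousAt.2 fun z => (hasDerivAt_deriv_besselClifford hν z).continuousAt

theorem continuous_besselClifford {ν : ℝ} (hν : ∀ k : ℕ, (k : ℝ) + ν + 1 ≠ 0) :
    Continuous (besselClifford ν) :=
  continuous_iff_continuousAt.2 fun z => (hasDerivAt_besselClifford hν z).continuousAt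

/-- Clifford's equation has the indicial exponents `0` and `-ν` at the origin; this is the solution
for `-ν`. -/
theorem isCliffordSolution_rpow_neg_mul {ν : ℝ} (hν : ∀ k : ℕ, (k : ℝ) + -ν + 1 ≠ 0) :
    IsCliffordSolution ν fun z => z ^ (-ν) * besselClifford (-ν) z := by
  refine .of_hasDerivAt
    (fun z hz => contDiffAt_rpow_neg_mul hz
      (contDiff_powerSum (IsEntireSeries.besselCoeff hν)).contDiffAt)
    (fun z hz => hasDerivAt_rpow_neg_mul hz (hasDerivAt_besselClifford hν z))
    (fun z hz => hasDerivAt_rpow_neg_mul_deriv hz (hasDerivAt_besselClifford hν z)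
      (hasDerivAt_deriv_besselClifford hν z)) fun z hz => ?_
  have := besselClifford_ode hν z
  apply mul_left_cancel₀ hz.ne'
  field_simp
  linear_combination z ^ (-ν) * z * this

/-! ### The Bessel function of the second kind as a second solution. -/

/-- The data needed about the second Bessel function of order `ν`. -/
structure IsSecondSolution (ν : ℝ) (y : ℝ → ℝ) : Prop where
  isCliffordSolution : IsCliffordSolution ν y
  besselY_eq : ∀ x, 0 < x → besselY ν x = (x / 2) ^ ν * y (x ^ 2 / 4)
  wronskian_ne_zero : ∀ z, 0 < z →
    besselClifford ν z * deriv y z - deriv (besselClifford ν) z * y z ≠ 0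

theorem exists_isSecondSolution_of_not_int {ν : ℝ} (hν : 0 ≤ ν) (hint : ∀ m : ℤ, ν ≠ m) :
    ∃ y, IsSecondSolution ν y := by
  have hp : ∀ k : ℕ, (k : ℝ) + ν + 1 ≠ 0 := fun k => by positivity
  have hm : ∀ k : ℕ, (k : ℝ) + -ν + 1 ≠ 0 := fun k h => hint (k + 1) (by push_cast; linarith)
  have hsin : Real.sin (ν * Real.pi) ≠ 0 := fun h => by
    obtain ⟨m, hm⟩ := Real.sin_eq_zero_iff.1 h
    exact hint m (mul_right_cancel₀ Real.pi_ne_zero hm).symm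
  set s := Real.sin (ν * Real.pi)
  set c := Real.cos (ν * Real.pi)
  have hC := isCliffordSolution_besselClifford hp
  have hK := isCliffordSolution_rpow_neg_mul hm
  have hy := hC.linearCombination hK (c / s) (-1 / s)
  refine ⟨_, hy, fun x hx => ?_, fun z hz => ?_⟩
  · have h1 : besselJ (-ν) x = (x / 2) ^ ν * ((x ^ 2 / 4) ^ (-ν) * besselClifford (-ν) (x ^ 2 / 4)) := by
      rw [besselJ_eq hx, ← mul_assoc, show x ^ 2 / 4 = (x / 2) * (x / 2) by ring,
        Real.mul_rpow (by positivity) (by positivity), ← mul_assoc,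
        ← Real.rpow_add (by positivity) ν, add_neg_cancel, Real.rpow_zero, one_mul]
    rw [besselY, if_neg (fun h => hint ⌊ν⌋₊ (by exact_mod_cast h)), h1, besselJ_eq hx]
    simp only [s, c] at hsin ⊢
    field_simp
    ring
  · refine hC.wronskian_ne_zero hy (g := fun z => -1 / s * (z * (besselClifford ν z *
      deriv (besselClifford (-ν)) z - deriv (besselClifford ν) z * besselClifford (-ν) z)
      - ν * besselClifford ν z * besselClifford (-ν) z)) ?_ ?_ (fun z hz => ?_) hz
    · have := continuous_besselClifford hp
      have := continuous_besselClifford hm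
      have := continuous_deriv_besselClifford hp
      have := continuous_deriv_besselClifford hm
      fun_prop
    -- Here `g 0 = ν / (s Γ(1 + ν) Γ(1 - ν))`, which is nonzero because `ν` is not an integer.
    · have h1 : ν ≠ 0 := fun h => hint 0 (by simpa using h)
      have h2 : Real.Gamma (ν + 1) ≠ 0 := (Real.Gamma_pos_of_pos (by positivity)).ne'
      have h3 : Real.Gamma (-ν + 1) ≠ 0 := by
        refine Real.Gamma_ne_zero fun m h => hint (m + 1) ?_
        push_cast
        linarith
      simp only [besselClifford_zero, zero_mul, zero_sub]
      have := inv_ne_zero h2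
      have := inv_ne_zero h3
      simp_all
    · have hd := ((hasDerivAt_besselClifford hp z).const_mul (c / s)).add
        ((hasDerivAt_rpow_neg_mul (ν := ν) hz (hasDerivAt_besselClifford hm z)).const_mul (-1 / s))
      have hd' : deriv (fun z => c / s * besselClifford ν z
          + -1 / s * (z ^ (-ν) * besselClifford (-ν) z)) z = _ := hd.deriv
      rw [hd', Real.rpow_add_one hz.ne', Real.rpow_neg hz.le]
      have : z ^ ν ≠ 0 := (Real.rpow_pos_of_pos hz ν).ne'
      field_simp
      ring

/-- The coefficients of the finite part of `Y_n`. -/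
def neumannCoeff (n k : ℕ) : ℝ :=
  if k < n then ((n - k - 1).factorial : ℝ) / (k.factorial : ℝ) else 0

/-- The coefficients of the digamma part of `Y_n`. -/
def digammaCoeff (n k : ℕ) : ℝ := (digammaSucc k + digammaSucc (n + k)) * besselCoeff n k

theorem isEntireSeries_neumannCoeff (n : ℕ) : IsEntireSeries (neumannCoeff n) := by
  intro r
  refine summable_of_ne_finset_zero (s := Finset.range n) fun k hk => ?_
  rw [neumannCoeff, if_neg (by simpa using hk)]
  simp

theorem abs_digammaSucc_le (m : ℕ) : |digammaSucc m| ≤ 1 + m := by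
  have h0 : (0 : ℝ) ≤ harmonic m ∧ (harmonic m : ℝ) ≤ m := by
    induction m with
    | zero => simp
    | succ m ih =>
      rw [harmonic_succ]
      push_cast
      have : ((m : ℝ) + 1)⁻¹ ≤ 1 := inv_le_one_of_one_le₀ (by linarith [Nat.cast_nonneg (α := ℝ) m])
      have : 0 ≤ ((m : ℝ) + 1)⁻¹ := by positivity
      constructor <;> linarith [ih.1, ih.2]
  have h1 := Real.one_half_lt_eulerMascheroniConstant
  have h2 := Real.eulerMascheroniConstant_lt_two_thirds
  rw [digammaSucc, abs_le]
  constructor <;> linarith [h0.1, h0.2]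

theorem natCast_add_add_one_ne_zero (n k : ℕ) : (k : ℝ) + (n : ℝ) + 1 ≠ 0 := by positivity

theorem isEntireSeries_digammaCoeff (n : ℕ) : IsEntireSeries (digammaCoeff n) := by
  refine (IsEntireSeries.besselCoeff (natCast_add_add_one_ne_zero n)).of_le (n + 2) fun k => ?_
  rw [digammaCoeff, abs_mul, ← mul_assoc]
  gcongr
  calc |digammaSucc k + digammaSucc (n + k)| ≤ (1 + k) + (1 + (n + k : ℕ)) :=
        (abs_add_le _ _).trans (add_le_add (abs_digammaSucc_le _) (abs_digammaSucc_le _))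
    _ ≤ ((n : ℝ) + 2) * (k + 1) := by
        push_cast
        nlinarith [mul_nonneg (Nat.cast_nonneg (α := ℝ) n) (Nat.cast_nonneg (α := ℝ) k)]
    _ ≤ _ := by gcongr; exact natCast_add_one_le_two_pow k

/-- The recurrence of order `-n` holds until the coefficients are cut off at `k = n`. The one defect
is `1/(n-1)! = n/n!`, written through `besselCoeff n 0 = 1/n!` so that it cancels against
`digamma_ode`. -/
theorem neumannCoeff_recurrence (n k : ℕ) :
    ((k : ℝ) + 1) * (k + 1 + -n) * neumannCoeff n (k + 1) + neumannCoeff n k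
      = if k + 1 = n then n * besselCoeff n 0 else 0 := by
  rcases lt_trichotomy (k + 1) n with h | h | h
  · obtain ⟨m, rfl⟩ := Nat.exists_eq_add_of_lt h
    rw [neumannCoeff, neumannCoeff, if_pos h, if_pos (by omega), if_neg h.ne,
      show k + 1 + m + 1 - (k + 1) - 1 = m by omega, show k + 1 + m + 1 - k - 1 = m + 1 by omega,
      Nat.factorial_succ, Nat.factorial_succ]
    push_cast
    field_simp
    ring
  · subst h
    rw [neumannCoeff, neumannCoeff, if_neg (by omega), if_pos (by omega), if_pos rfl, besselCoeff]
    have := Real.Gamma_nat_eq_factorial (k + 1)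
    push_cast at this
    simp only [Nat.cast_zero, zero_add, pow_zero, Nat.factorial_zero, Nat.cast_one, one_mul,
      Nat.cast_add, this, Nat.factorial_succ, show k + 1 - k - 1 = 0 by omega]
    push_cast
    field_simp
    ring
  · rw [neumannCoeff, neumannCoeff, if_neg (by omega), if_neg (by omega), if_neg (by omega)]
    ring

/-- The defect of the finite part of `Y_n` in the equation of order `-n`; multiplication by `z^(-n)`
carries it over to the equation of order `n`. -/
theorem neumann_ode (n : ℕ) (z : ℝ) :
    z * (z * powerSum (derivCoeff (derivCoeff (neumannCoeff n))) z
      + (1 - n) * powerSum (derivCoeff (neumannCoeff n)) z + powerSum (neumannCoeff n) z)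
      = n * besselCoeff n 0 * z ^ n := by
  have h := powerSum_ode (isEntireSeries_neumannCoeff n) (-n) z
  simp only [neumannCoeff_recurrence] at h
  rw [show (1 - n : ℝ) = -n + 1 by ring, h, powerSum]
  rcases n with _ | n
  · simp
  · rw [tsum_eq_single n (fun k hk => by rw [if_neg (by omega), zero_mul]), if_pos rfl]
    ring

theorem digammaSucc_succ (m : ℕ) : digammaSucc (m + 1) = digammaSucc m + ((m : ℝ) + 1)⁻¹ := by
  rw [digammaSucc, digammaSucc, harmonic_succ]
  push_cast
  ring

/-- Applying Clifford's operator to `log z · C_n` leaves `2 C_n' + n C_n / z`. The increments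
`1/(k+1)` and `1/(n+k+1)` of the digamma weights produce the same terms, except for the constant
term `n besselCoeff n 0`, which the finite part supplies. -/
theorem digamma_ode (n : ℕ) (z : ℝ) :
    z * (z * powerSum (derivCoeff (derivCoeff (digammaCoeff n))) z
      + (n + 1) * powerSum (derivCoeff (digammaCoeff n)) z + powerSum (digammaCoeff n) z)
      = 2 * z * powerSum (derivCoeff (besselCoeff n)) z + n * powerSum (besselCoeff n) z
        - n * besselCoeff n 0 := by
  have hb := IsEntireSeries.besselCoeff (natCast_add_add_one_ne_zero n)
  have hs : IsEntireSeries fun k => (2 * (k : ℝ) + n) * besselCoeff n k := by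
    refine hb.of_le (n + 2) fun k => ?_
    rw [abs_mul, abs_of_nonneg (by positivity), ← mul_assoc]
    gcongr
    calc 2 * (k : ℝ) + n ≤ ((n : ℝ) + 2) * (k + 1) := by
          nlinarith [mul_nonneg (Nat.cast_nonneg (α := ℝ) n) (Nat.cast_nonneg (α := ℝ) k)]
      _ ≤ _ := by gcongr; exact natCast_add_one_le_two_pow k
  have h1 : (fun k : ℕ => ((k : ℝ) + 1) * (k + 1 + n) * digammaCoeff n (k + 1) + digammaCoeff n k)
      = fun k => (2 * ((k + 1 : ℕ) : ℝ) + n) * besselCoeff n (k + 1) := by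
    ext k
    have := besselCoeff_recurrence (natCast_add_add_one_ne_zero n) k
    rw [digammaCoeff, digammaCoeff, ← add_assoc, digammaSucc_succ, digammaSucc_succ]
    rw [← neg_eq_iff_eq_neg] at this
    rw [← this]
    push_cast
    field_simp
    ring
  have hk : z * powerSum (derivCoeff (besselCoeff n)) z
      = powerSum (fun k => (k : ℝ) * besselCoeff n k) z := by
    have hk' : IsEntireSeries fun k => (k : ℝ) * besselCoeff n k := by
      refine hb.of_le 1 fun k => ?_
      rw [abs_mul, one_mul, abs_of_nonneg (by positivity)]
      gcongr
      linarith [natCast_add_one_le_two_pow k]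
    have := mul_powerSum_shift hk' z
    simp only [Nat.cast_zero, zero_mul, sub_zero] at this
    rw [← this]
    congr 2
    ext k
    rw [derivCoeff]
    push_cast
    ring
  have hk' : Summable fun k : ℕ => (k : ℝ) * besselCoeff n k * z ^ k := by
    refine ((hs.summable z).sub ((hb.summable z).mul_left (n : ℝ))).div_const 2 |>.congr fun k => ?_
    ring
  rw [powerSum_ode (isEntireSeries_digammaCoeff n), h1, mul_powerSum_shift hs, mul_assoc, hk,
    powerSum, powerSum, powerSum, ← tsum_mul_left, ← tsum_mul_left,
    ← (hk'.mul_left 2).tsum_add ((hb.summable z).mul_left _)]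
  congr 1
  · exact tsum_congr fun k => by ring
  · simp

theorem besselYNat_eq (n : ℕ) {x : ℝ} (hx : 0 < x) :
    besselYNat n x = (x / 2) ^ (n : ℝ) * (1 / Real.pi * (Real.log (x ^ 2 / 4) *
      besselClifford n (x ^ 2 / 4) - (x ^ 2 / 4) ^ (-(n : ℝ)) * powerSum (neumannCoeff n) (x ^ 2 / 4)
      - powerSum (digammaCoeff n) (x ^ 2 / 4))) := by
  have hx2 : x / 2 ≠ 0 := by positivity
  have h1 : Real.log (x ^ 2 / 4) = 2 * Real.log (x / 2) := by
    rw [show x ^ 2 / 4 = (x / 2) ^ 2 by ring, Real.log_pow]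
    norm_num
  have h2 : ∑ k ∈ Finset.range n,
        ((n - k - 1).factorial : ℝ) / (k.factorial : ℝ) * (x / 2) ^ (2 * (k : ℤ) - (n : ℤ))
      = (x / 2) ^ (n : ℝ) * ((x ^ 2 / 4) ^ (-(n : ℝ)) * powerSum (neumannCoeff n) (x ^ 2 / 4)) := by
    rw [powerSum, tsum_eq_sum (s := Finset.range n) (fun k hk => by
      rw [neumannCoeff, if_neg (by simpa using hk), zero_mul]), Finset.mul_sum, Finset.mul_sum]
    refine Finset.sum_congr rfl fun k hk => ?_
    rw [neumannCoeff, if_pos (by simpa using hk), show x ^ 2 / 4 = (x / 2) ^ 2 by ring,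
      Real.rpow_neg (by positivity), Real.rpow_natCast, Real.rpow_natCast, zpow_sub₀ hx2,
      zpow_natCast, zpow_mul, zpow_natCast]
    norm_cast
    rw [← pow_mul, ← pow_mul]
    have := pow_ne_zero n hx2
    field_simp
    ring
  have h3 : ∑' k : ℕ, (digammaSucc k + digammaSucc (n + k))
          * ((-1 : ℝ) ^ k / ((k.factorial : ℝ) * ((n + k).factorial : ℝ)))
          * (x / 2) ^ (2 * k + n) = (x / 2) ^ (n : ℝ) * powerSum (digammaCoeff n) (x ^ 2 / 4) := by
    rw [powerSum, ← tsum_mul_left]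
    refine tsum_congr fun k => ?_
    have := Real.Gamma_nat_eq_factorial (n + k)
    push_cast at this
    rw [digammaCoeff, besselCoeff, ← this, Real.rpow_natCast, show x ^ 2 / 4 = (x / 2) ^ 2 by ring,
      add_comm (k : ℝ) n, ← pow_mul]
    ring
  rw [besselYNat, h2, h3, h1, besselJ_eq hx]
  ring

theorem exists_isSecondSolution_natCast (n : ℕ) : ∃ y, IsSecondSolution (n : ℝ) y := by
  have hp := natCast_add_add_one_ne_zero n
  have hc := IsEntireSeries.besselCoeff hp
  have hn := isEntireSeries_neumannCoeff n
  have hd := isEntireSeries_digammaCoeff n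
  have hC := isCliffordSolution_besselClifford hp
  have hd1 : ∀ z, 0 < z → HasDerivAt (fun z => 1 / Real.pi * (Real.log z * besselClifford n z
      - z ^ (-(n : ℝ)) * powerSum (neumannCoeff n) z - powerSum (digammaCoeff n) z))
      (1 / Real.pi * (z⁻¹ * besselClifford n z + Real.log z * deriv (besselClifford n) z
      - z ^ (-(n : ℝ)) * (powerSum (derivCoeff (neumannCoeff n)) z
        - n * powerSum (neumannCoeff n) z / z) - powerSum (derivCoeff (digammaCoeff n)) z)) z :=
    fun z hz => ((((Real.hasDerivAt_log hz.ne').mul (hasDerivAt_besselClifford hp z)).sub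
      (hasDerivAt_rpow_neg_mul hz (hasDerivAt_powerSum hn z))).sub
      (hasDerivAt_powerSum hd z)).const_mul _
  have hd2 : ∀ z, 0 < z → HasDerivAt (fun z => 1 / Real.pi * (z⁻¹ * besselClifford n z
        + Real.log z * deriv (besselClifford n) z
      - z ^ (-(n : ℝ)) * (powerSum (derivCoeff (neumannCoeff n)) z
        - n * powerSum (neumannCoeff n) z / z) - powerSum (derivCoeff (digammaCoeff n)) z))
      (1 / Real.pi * (-(z ^ 2)⁻¹ * besselClifford n z + z⁻¹ * deriv (besselClifford n) z
        + (z⁻¹ * deriv (besselClifford n) z + Real.log z * deriv (deriv (besselClifford n)) z)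
      - z ^ (-(n : ℝ)) * (powerSum (derivCoeff (derivCoeff (neumannCoeff n))) z
        - 2 * n * powerSum (derivCoeff (neumannCoeff n)) z / z
        + n * (n + 1) * powerSum (neumannCoeff n) z / z ^ 2)
      - powerSum (derivCoeff (derivCoeff (digammaCoeff n))) z)) z :=
    fun z hz => (((((hasDerivAt_inv hz.ne').mul (hasDerivAt_besselClifford hp z)).add
      ((Real.hasDerivAt_log hz.ne').mul (hasDerivAt_deriv_besselClifford hp z))).sub
      (hasDerivAt_rpow_neg_mul_deriv hz (hasDerivAt_powerSum hn z)
        (hasDerivAt_powerSum hn.derivCoeff z))).sub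
      (hasDerivAt_powerSum hd.derivCoeff z)).const_mul _
  have hy := IsCliffordSolution.of_hasDerivAt (ν := n) (fun z hz => contDiffAt_const.mul
    ((((Real.contDiffAt_log.2 hz.ne').mul (hC.contDiffAt z hz)).sub
      (contDiffAt_rpow_neg_mul hz (contDiff_powerSum hn).contDiffAt)).sub
      (contDiff_powerSum hd).contDiffAt)) hd1 hd2 (fun z hz => by
    have h1 := besselClifford_ode hp z
    have h2 := neumann_ode n z
    have h3 := digamma_ode n z
    have h4 : z ^ (-(n : ℝ)) * z ^ n = 1 := by
      rw [← Real.rpow_natCast, ← Real.rpow_add hz]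
      simp
    rw [← deriv_powerSum hc, ← besselClifford] at h3
    -- The defects of the logarithmic, finite and digamma parts cancel.
    apply mul_left_cancel₀ (mul_ne_zero hz.ne' Real.pi_ne_zero)
    field_simp
    linear_combination z * Real.log z * h1 - z ^ (-(n : ℝ)) * h2 - h3 - n * besselCoeff n 0 * h4)
  refine ⟨_, hy, fun x hx => ?_, fun z hz => ?_⟩
  · rw [besselY, if_pos (by simp), Nat.floor_natCast, besselYNat_eq n hx]
  · refine hC.wronskian_ne_zero hy (g := fun z => 1 / Real.pi * (z ^ n * besselClifford n z ^ 2
      - z * (besselClifford n z * powerSum (derivCoeff (neumannCoeff n)) z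
        - deriv (besselClifford n) z * powerSum (neumannCoeff n) z)
      + n * besselClifford n z * powerSum (neumannCoeff n) z
      - z ^ (n + 1) * (besselClifford n z * powerSum (derivCoeff (digammaCoeff n)) z
        - deriv (besselClifford n) z * powerSum (digammaCoeff n) z))) ?_ ?_ (fun z hz => ?_) hz
    · have := continuous_besselClifford hp
      have := continuous_deriv_besselClifford hp
      have := (contDiff_powerSum hn).continuous
      have := (contDiff_powerSum hn.derivCoeff).continuous
      have := (contDiff_powerSum hd).continuous
      have := (contDiff_powerSum hd.derivCoeff).continuous
      fun_prop
    -- In both cases `g 0 = 1/π`: for `n = 0` only the square term survives, and for `n > 0` only `n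
    -- C_n(0)` times the leading finite coefficient `(n-1)!`.
    · simp only [besselClifford_zero, powerSum_zero, Real.Gamma_nat_eq_factorial]
      rcases n with _ | n
      · simp [Real.pi_ne_zero]
      · simp only [neumannCoeff, Nat.factorial_succ]
        have := n.factorial_ne_zero
        simp [Real.pi_ne_zero]
        exact ⟨⟨by positivity, this, by positivity⟩, this⟩
    · rw [(hd1 z hz).deriv, Real.rpow_add_one hz.ne', Real.rpow_neg hz.le, Real.rpow_natCast]
      field_simp
      ring

/-- The order is an integer for even `N` and a half-integer for odd `N`. -/
theorem exists_isSecondSolution {N : ℕ} (hN : 2 ≤ N) (l : ℕ) :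
    ∃ y, IsSecondSolution (besselOrder N l) y := by
  rcases Nat.even_or_odd' N with ⟨m, rfl | rfl⟩
  · have : besselOrder (2 * m) l = ((l + m - 1 : ℕ) : ℝ) := by
      rw [besselOrder, Nat.cast_sub (by omega)]
      push_cast
      ring
    rw [this]
    exact exists_isSecondSolution_natCast _
  · refine exists_isSecondSolution_of_not_int ?_ fun k hk => ?_
    · have : (1 : ℝ) ≤ m := by exact_mod_cast (by omega : 1 ≤ m)
      rw [besselOrder]
      push_cast
      linarith [Nat.cast_nonneg (α := ℝ) l]
    · rw [besselOrder] at hk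
      push_cast at hk
      have : (2 * l + 2 * m + 1 - 2 : ℝ) = 2 * k := by linarith
      have : (2 * l + 2 * m + 1 - 2 : ℤ) = 2 * k := by exact_mod_cast this
      omega

/-! ### The cross-product equation in Clifford's variables. -/

theorem deriv_of_eq_rpow_mul {ν x : ℝ} {Z y : ℝ → ℝ} (hy : IsCliffordSolution ν y)
    (hZ : ∀ x, 0 < x → Z x = (x / 2) ^ ν * y (x ^ 2 / 4)) (hx : 0 < x) :
    deriv Z x = (x / 2) ^ ν * (ν / x * y (x ^ 2 / 4) + x / 2 * deriv y (x ^ 2 / 4)) := by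
  have e : Z =ᶠ[nhds x] fun x => (x / 2) ^ ν * y (x ^ 2 / 4) := by
    filter_upwards [lt_mem_nhds hx] with w hw using hZ w hw
  rw [e.deriv_eq]
  have h1 : HasDerivAt (fun x : ℝ => x / 2) (1 / 2) x := (hasDerivAt_id' x).div_const 2
  have h2 : HasDerivAt (fun x : ℝ => x ^ 2 / 4) (x / 2) x :=
    ((hasDerivAt_pow 2 x).div_const 4).congr_deriv (by norm_num; ring)
  have h3 := ((Real.hasDerivAt_rpow_const (p := ν) (.inl (by positivity : x / 2 ≠ 0))).comp x
    h1).mul ((hy.hasDerivAt (by positivity : 0 < x ^ 2 / 4)).comp x h2)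
  refine (h3.congr_deriv ?_).deriv
  rw [Real.rpow_sub_one (by positivity)]
  simp only [Function.comp]
  field_simp

theorem besselOrder_nonneg {N : ℕ} (hN : 2 ≤ N) (l : ℕ) : 0 ≤ besselOrder N l := by
  have : (2 : ℝ) ≤ N := by exact_mod_cast hN
  rw [besselOrder]
  linarith [Nat.cast_nonneg (α := ℝ) l]

theorem isCliffordSolution_besselOrder {N : ℕ} (hN : 2 ≤ N) (l : ℕ) :
    IsCliffordSolution (besselOrder N l) (besselClifford (besselOrder N l)) :=
  isCliffordSolution_besselClifford fun k => by
    have := besselOrder_nonneg hN l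
    positivity

/-- The cross-product equation in terms of the solutions `C_ν` and `y` of Clifford's equation. -/
theorem cross_eq_zero_iff {N : ℕ} (hN : 2 ≤ N) (l : ℕ) {y : ℝ → ℝ}
    (hy : IsSecondSolution (besselOrder N l) y) {M ε lam ci co : ℝ} (hε0 : 0 < ε) (hε1 : ε < 1)
    (hρ : 0 < rhoTilde N M ε) (hlam : 0 < lam) (hci : ci = lam * ε / 4)
    (hco : co = lam * rhoTilde N M ε / 4) :
    (1 - (N : ℝ) / 2) * crossP1 (besselOrder N l) ε (aParam ε lam) (bParam N M ε lam)
        + bParam N M ε lam / (1 - ε) *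
          crossP2 (besselOrder N l) ε (aParam ε lam) (bParam N M ε lam) = 0 ↔
      (co * besselClifford (besselOrder N l) (ci * (1 - ε) ^ 2) * deriv y (co * (1 - ε) ^ 2)
        - ci * deriv (besselClifford (besselOrder N l)) (ci * (1 - ε) ^ 2) * y (co * (1 - ε) ^ 2))
        * (l * besselClifford (besselOrder N l) co
          + 2 * co * deriv (besselClifford (besselOrder N l)) co)
      + (ci * deriv (besselClifford (besselOrder N l)) (ci * (1 - ε) ^ 2)
          * besselClifford (besselOrder N l) (co * (1 - ε) ^ 2)
        - co * besselClifford (besselOrder N l) (ci * (1 - ε) ^ 2)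
          * deriv (besselClifford (besselOrder N l)) (co * (1 - ε) ^ 2))
        * (l * y co + 2 * co * deriv y co) = 0 := by
  have hC := isCliffordSolution_besselOrder hN l
  have hJ := fun x (hx : 0 < x) => besselJ_eq (ν := besselOrder N l) hx
  have hY := hy.besselY_eq
  have hJ' := fun x (hx : 0 < x) => deriv_of_eq_rpow_mul hC hJ hx
  have hY' := fun x (hx : 0 < x) => deriv_of_eq_rpow_mul hy.isCliffordSolution hY hx
  -- Since `1 - N/2 + ν = l`, the boundary expression `(1 - N/2) Z(k) + k Z'(k)` equals `(k/2)^ν (l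
  -- y + 2 z y')` at `z = k²/4`, for `Z = J_ν` or `Y_ν`.
  have hN' : (N : ℝ) / 2 = besselOrder N l - l + 1 := by rw [besselOrder]; ring
  set ν := besselOrder N l
  obtain ⟨ki, hki, hki0⟩ : ∃ k, k = Real.sqrt (lam * ε) ∧ 0 < k := ⟨_, rfl, by positivity⟩
  obtain ⟨ko, hko, hko0⟩ : ∃ k, k = Real.sqrt (lam * rhoTilde N M ε) ∧ 0 < k :=
    ⟨_, rfl, by positivity⟩
  obtain ⟨r, hr, hr0⟩ : ∃ r, r = 1 - ε ∧ 0 < r := ⟨_, rfl, by linarith⟩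
  have hki2 : ki ^ 2 = 4 * ci := by rw [hki, Real.sq_sqrt (by positivity), hci]; ring
  have hko2 : ko ^ 2 = 4 * co := by rw [hko, Real.sq_sqrt (by positivity), hco]; ring
  have ha : (ki * r) ^ 2 / 4 = ci * r ^ 2 := by rw [mul_pow, hki2]; ring
  have hb : (ko * r) ^ 2 / 4 = co * r ^ 2 := by rw [mul_pow, hko2]; ring
  have hb' : ko ^ 2 / 4 = co := by rw [hko2]; ring
  have hbr : ko * r / r = ko := by field_simp
  have har := mul_pos hki0 hr0
  have hbr0 := mul_pos hko0 hr0
  rw [aParam, bParam, ← hki, ← hko, ← hr, crossP1, crossP2, ← hr, hbr, hJ _ har, hJ _ hbr0,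
    hJ _ hko0, hY _ hbr0, hY _ hko0, hJ' _ har, hJ' _ hbr0, hJ' _ hko0, hY' _ hbr0, hY' _ hko0,
    ha, hb, hb', hN']
  obtain ⟨Pa, hPa, hPa0⟩ : ∃ p, p = (ki * r / 2) ^ ν ∧ 0 < p := ⟨_, rfl, by positivity⟩
  obtain ⟨Pb, hPb, hPb0⟩ : ∃ p, p = (ko * r / 2) ^ ν ∧ 0 < p := ⟨_, rfl, by positivity⟩
  obtain ⟨Pk, hPk, hPk0⟩ : ∃ p, p = (ko / 2) ^ ν ∧ 0 < p := ⟨_, rfl, by positivity⟩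
  rw [← hPa, ← hPb, ← hPk]
  generalize besselClifford ν (ci * r ^ 2) = Ci
  generalize deriv (besselClifford ν) (ci * r ^ 2) = Ci'
  generalize besselClifford ν (co * r ^ 2) = Cb
  generalize deriv (besselClifford ν) (co * r ^ 2) = Cb'
  generalize besselClifford ν co = Ck
  generalize deriv (besselClifford ν) co = Ck'
  generalize y (co * r ^ 2) = Yb
  generalize deriv y (co * r ^ 2) = Yb'
  generalize y co = Yk
  generalize deriv y co = Yk'
  have hci' : ci = ki ^ 2 / 4 := by linarith
  have hco' : co = ko ^ 2 / 4 := by linarith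
  -- The terms with `ν` cancel inside the interface brackets at `a` and `b`. Three powers `(·/2)^ν`
  -- factor out, and `2r/ko` comes from `b/2 = (2r/ko) co` and `a²/(2b) = (2r/ko) ci`.
  have hK : Pa * Pb * Pk * (2 * r / ko) ≠ 0 := by positivity
  have key : ∀ X Y : ℝ, X = Pa * Pb * Pk * (2 * r / ko) * Y → (X = 0 ↔ Y = 0) := fun X Y h => by
    rw [h, mul_eq_zero, or_iff_right hK]
  refine key _ _ ?_
  rw [hci', hco']
  field_simp
  ring

/-! ### Homogeneous harmonic polynomials. -/

section Harmonic

open MvPolynomial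

/-- The Laplacian on polynomials. -/
def polyLaplacian (N : ℕ) : MvPolynomial (Fin N) ℝ →ₗ[ℝ] MvPolynomial (Fin N) ℝ :=
  ∑ i, (pderiv i).toLinearMap ∘ₗ (pderiv i).toLinearMap

/-- The polynomial `|x|²`. -/
def normSqPoly (N : ℕ) : MvPolynomial (Fin N) ℝ := ∑ i, X i ^ 2

theorem polyLaplacian_apply {N : ℕ} (p : MvPolynomial (Fin N) ℝ) :
    polyLaplacian N p = ∑ i, pderiv i (pderiv i p) := by
  simp [polyLaplacian]

theorem isHomogeneous_normSqPoly (N : ℕ) : (normSqPoly N).IsHomogeneous 2 :=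
  IsHomogeneous.sum _ _ _ fun i _ => isHomogeneous_X_pow i 2

theorem pderiv_normSqPoly {N : ℕ} (i : Fin N) : pderiv i (normSqPoly N) = 2 * X i := by
  rw [normSqPoly, map_sum, Finset.sum_eq_single i]
  · simp
  · intro j _ hj
    simp [pderiv_X_of_ne hj]
  · simp

/-- The cross term `4 ∑ x_i ∂_i q` is `4 m q` by Euler's identity. -/
theorem polyLaplacian_normSqPoly_mul {N m : ℕ} {q : MvPolynomial (Fin N) ℝ}
    (hq : q.IsHomogeneous m) :
    polyLaplacian N (normSqPoly N * q)
      = (2 * N + 4 * m : ℝ) • q + normSqPoly N * polyLaplacian N q := by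
  have h := hq.sum_X_mul_pderiv
  have e : ∀ i, pderiv i (pderiv i (normSqPoly N * q))
      = 2 * q + 4 * (X i * pderiv i q) + normSqPoly N * pderiv i (pderiv i q) := by
    intro i
    have : pderiv i (2 : MvPolynomial (Fin N) ℝ) = 0 := pderiv_C (R := ℝ) (a := 2) (i := i)
    simp only [pderiv_mul, pderiv_normSqPoly, map_add, pderiv_X_self, this]
    ring
  rw [polyLaplacian_apply, polyLaplacian_apply, Finset.sum_congr rfl fun i _ => e i,
    Finset.sum_add_distrib, Finset.sum_add_distrib, ← Finset.mul_sum, ← Finset.mul_sum,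
    ← Finset.mul_sum, h, Finset.sum_const, Finset.card_univ, Fintype.card_fin, smul_eq_C_mul]
  simp only [map_add, map_mul, nsmul_eq_mul, map_natCast, map_ofNat]
  ring

theorem polyLaplacian_normSqPoly_pow_mul {N m : ℕ} {q : MvPolynomial (Fin N) ℝ}
    (hq : q.IsHomogeneous m) (j : ℕ) :
    polyLaplacian N (normSqPoly N ^ (j + 1) * q)
      = (2 * (j + 1) * (N + 2 * m + 2 * j) : ℝ) • (normSqPoly N ^ j * q)
        + normSqPoly N ^ (j + 1) * polyLaplacian N q := by
  induction j with
  | zero =>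
    rw [zero_add, pow_one, polyLaplacian_normSqPoly_mul hq]
    congr 2
    · push_cast; ring
    · simp
  | succ j ih =>
    rw [pow_succ' _ (j + 1), mul_assoc,
      polyLaplacian_normSqPoly_mul (((isHomogeneous_normSqPoly N).pow (j + 1)).mul hq), ih]
    simp only [smul_eq_C_mul, map_add, map_mul, Nat.cast_add, Nat.cast_one, Nat.cast_mul,
      Nat.cast_ofNat, map_natCast, map_ofNat, map_one]
    ring

theorem isHomogeneous_polyLaplacian {N m : ℕ} {p : MvPolynomial (Fin N) ℝ}
    (hp : p.IsHomogeneous (m + 2)) : (polyLaplacian N p).IsHomogeneous m := by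
  rw [polyLaplacian_apply]
  exact IsHomogeneous.sum _ _ _ fun i _ => hp.pderiv.pderiv

theorem polyLaplacian_eq_zero_of_lt_two {N m : ℕ} {p : MvPolynomial (Fin N) ℝ}
    (hp : p.IsHomogeneous m) (hm : m < 2) : polyLaplacian N p = 0 := by
  rw [polyLaplacian_apply]
  refine Finset.sum_eq_zero fun i _ => ?_
  have h : (pderiv i p).IsHomogeneous 0 := by
    have := hp.pderiv (i := i)
    rwa [show m - 1 = 0 by omega] at this
  rw [← totalDegree_zero_iff_isHomogeneous, totalDegree_eq_zero_iff_eq_C] at h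
  rw [h, pderiv_C]

/-- Take `q` proportional to `p`: the error is a multiple of `|x|^(2(j+1)) Δp`, where `Δp` has
degree `m - 2`. It is removed by the induction hypothesis with `j + 1` in place of `j`, which is why
`j` is quantified inside the induction. -/
theorem exists_polyLaplacian_eq {N : ℕ} (hN : 0 < N) (m : ℕ) :
    ∀ (j : ℕ) (p : MvPolynomial (Fin N) ℝ), p.IsHomogeneous m →
      ∃ q : MvPolynomial (Fin N) ℝ, q.IsHomogeneous m ∧
        polyLaplacian N (normSqPoly N ^ (j + 1) * q) = normSqPoly N ^ j * p := by
  induction m using Nat.strong_induction_on with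
  | _ m ih =>
    intro j p hp
    have hc : (2 * (j + 1) * (N + 2 * m + 2 * j) : ℝ) ≠ 0 := by positivity
    have hs : ∃ s : MvPolynomial (Fin N) ℝ, (normSqPoly N * s).IsHomogeneous m ∧
        polyLaplacian N (normSqPoly N ^ (j + 1) * (normSqPoly N * s))
          = normSqPoly N ^ (j + 1) * polyLaplacian N p := by
      rcases lt_or_ge m 2 with h | h
      · refine ⟨0, by simpa using isHomogeneous_zero _ _ _, ?_⟩
        rw [polyLaplacian_eq_zero_of_lt_two hp h]
        simp
      · obtain ⟨k, rfl⟩ := Nat.exists_eq_add_of_le' h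
        obtain ⟨s, hs, hs'⟩ := ih k (by omega) (j + 1) _ (isHomogeneous_polyLaplacian hp)
        refine ⟨s, ?_, by rw [← mul_assoc, ← pow_succ, hs']⟩
        rw [add_comm]
        exact (isHomogeneous_normSqPoly N).mul hs
    obtain ⟨s, hs, hs'⟩ := hs
    -- The constant is the coefficient of `|x|^(2j) p` in `Δ(|x|^(2(j+1)) p)`, and `|x|² s` cancels
    -- the remainder.
    refine ⟨(2 * (j + 1) * (N + 2 * m + 2 * j) : ℝ)⁻¹ • (p - normSqPoly N * s), ?_, ?_⟩
    · exact (homogeneousSubmodule _ _ m).smul_mem _ (hp.sub hs)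
    · rw [mul_smul_comm, map_smul, mul_sub, map_sub, polyLaplacian_normSqPoly_pow_mul hp, hs',
        add_sub_cancel_right, smul_smul, inv_mul_cancel₀ hc, one_smul]

/-- Every polynomial is a combination of products of powers of `|x|²` and homogeneous harmonic
polynomials. -/
theorem eq_top_of_normSqPoly_pow_mul_mem {N : ℕ} (hN : 0 < N)
    (S : Submodule ℝ (MvPolynomial (Fin N) ℝ))
    (hS : ∀ (l j : ℕ) (H : MvPolynomial (Fin N) ℝ), H.IsHomogeneous l → polyLaplacian N H = 0 →
      normSqPoly N ^ j * H ∈ S) : S = ⊤ := by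
  have key : ∀ (m j : ℕ) (p : MvPolynomial (Fin N) ℝ), p.IsHomogeneous m →
      normSqPoly N ^ j * p ∈ S := by
    intro m
    induction m using Nat.strong_induction_on with
    | _ m ih =>
      intro j p hp
      rcases lt_or_ge m 2 with h | h
      · exact hS m j p hp (polyLaplacian_eq_zero_of_lt_two hp h)
      · obtain ⟨k, rfl⟩ := Nat.exists_eq_add_of_le' h
        -- With `Δ(|x|² q) = Δp`, the splitting `p = (p - |x|² q) + |x|² q` has a harmonic first
        -- summand, and `q` has lower degree.
        obtain ⟨q, hq, hq'⟩ := exists_polyLaplacian_eq hN k 0 _ (isHomogeneous_polyLaplacian hp)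
        rw [zero_add, pow_one, pow_zero, one_mul] at hq'
        have h2 : (normSqPoly N * q).IsHomogeneous (k + 2) := by
          rw [add_comm]
          exact (isHomogeneous_normSqPoly N).mul hq
        have h3 := hS (k + 2) j (p - normSqPoly N * q) (hp.sub h2) (by rw [map_sub, hq', sub_self])
        have h4 := ih k (by omega) (j + 1) q hq
        have := S.add_mem h3 h4
        rwa [show normSqPoly N ^ j * (p - normSqPoly N * q) + normSqPoly N ^ (j + 1) * q
          = normSqPoly N ^ j * p by ring] at this
  rw [eq_top_iff]
  intro p _
  rw [← sum_homogeneousComponent p]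
  refine S.sum_mem fun m _ => ?_
  simpa using key m 0 _ (homogeneousComponent_isHomogeneous m p)

/-- The real and imaginary parts of `(x + i y)^l`. -/
def planarHarmonic {σ : Type*} (i j : σ) : ℕ → MvPolynomial σ ℝ × MvPolynomial σ ℝ
  | 0 => (1, 0)
  | l + 1 => (X i * (planarHarmonic i j l).1 - X j * (planarHarmonic i j l).2,
      X i * (planarHarmonic i j l).2 + X j * (planarHarmonic i j l).1)

theorem isHomogeneous_planarHarmonic {σ : Type*} (i j : σ) (l : ℕ) :
    (planarHarmonic i j l).1.IsHomogeneous l ∧ (planarHarmonic i j l).2.IsHomogeneous l := by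
  induction l with
  | zero => exact ⟨isHomogeneous_one _ _, isHomogeneous_zero _ _ _⟩
  | succ l ih =>
    rw [add_comm l 1, add_comm 1 l, planarHarmonic, add_comm l 1]
    exact ⟨((isHomogeneous_X _ i).mul ih.1).sub ((isHomogeneous_X _ j).mul ih.2),
      ((isHomogeneous_X _ i).mul ih.2).add ((isHomogeneous_X _ j).mul ih.1)⟩

theorem pderiv_planarHarmonic_of_ne {σ : Type*} {i j k : σ} (hki : k ≠ i) (hkj : k ≠ j) (l : ℕ) :
    pderiv k (planarHarmonic i j l).1 = 0 ∧ pderiv k (planarHarmonic i j l).2 = 0 := by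
  induction l with
  | zero => simp [planarHarmonic]
  | succ l ih =>
    simp [planarHarmonic, pderiv_X_of_ne hki.symm, pderiv_X_of_ne hkj.symm, ih.1, ih.2]

theorem pderiv_planarHarmonic {σ : Type*} {i j : σ} (hij : i ≠ j) (l : ℕ) :
    pderiv i (planarHarmonic i j (l + 1)).1 = (l + 1) * (planarHarmonic i j l).1 ∧
    pderiv i (planarHarmonic i j (l + 1)).2 = (l + 1) * (planarHarmonic i j l).2 ∧
    pderiv j (planarHarmonic i j (l + 1)).1 = -(l + 1) * (planarHarmonic i j l).2 ∧
    pderiv j (planarHarmonic i j (l + 1)).2 = (l + 1) * (planarHarmonic i j l).1 := by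
  induction l with
  | zero =>
    simp [planarHarmonic, pderiv_X_of_ne hij, pderiv_X_of_ne hij.symm]
  | succ l ih =>
    obtain ⟨h1, h2, h3, h4⟩ := ih
    rw [planarHarmonic]
    simp only [map_sub, map_add, pderiv_mul, pderiv_X_of_ne hij, pderiv_X_of_ne hij.symm,
      pderiv_X_self, h1, h2, h3, h4]
    rw [planarHarmonic]
    push_cast
    refine ⟨?_, ?_, ?_, ?_⟩ <;> ring

/-- The second derivatives in the two chosen directions cancel by the Cauchy–Riemann relations. This
supplies a harmonic polynomial in every degree, from which the eigenfunctions are built. -/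
theorem polyLaplacian_planarHarmonic {N : ℕ} {i j : Fin N} (hij : i ≠ j) (l : ℕ) :
    polyLaplacian N (planarHarmonic i j l).1 = 0 := by
  rcases lt_or_ge l 2 with h | h
  · exact polyLaplacian_eq_zero_of_lt_two (isHomogeneous_planarHarmonic i j l).1 h
  obtain ⟨l, rfl⟩ := Nat.exists_eq_add_of_le' h
  have hc : ∀ (k : Fin N) (p : MvPolynomial (Fin N) ℝ),
      pderiv k ((((l + 1 : ℕ) : MvPolynomial (Fin N) ℝ) + 1) * p)
        = (((l + 1 : ℕ) : MvPolynomial (Fin N) ℝ) + 1) * pderiv k p := by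
    intro k p
    rw [pderiv_mul, map_add, pderiv_one, Derivation.map_natCast, add_zero, zero_mul, zero_add]
  rw [polyLaplacian_apply, Finset.sum_eq_add i j hij]
  · obtain ⟨h1, h2, h3, h4⟩ := pderiv_planarHarmonic hij (l + 1)
    obtain ⟨g1, g2, g3, g4⟩ := pderiv_planarHarmonic hij l
    rw [h1, h3, neg_mul, map_neg, hc, hc, g1, g4]
    ring
  · intro k _ hk
    rw [(pderiv_planarHarmonic_of_ne hk.1 hk.2 _).1, map_zero]
  · simp
  · simp

end Harmonic

/-! ### Polynomial functions on Euclidean space. -/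

section PolyEval

/-- The polynomial function on Euclidean space. -/
def polyEval {N : ℕ} (p : MvPolynomial (Fin N) ℝ) (x : EuclideanSpace ℝ (Fin N)) : ℝ :=
  MvPolynomial.eval (fun i => x i) p

theorem polyEval_add {N : ℕ} (p q : MvPolynomial (Fin N) ℝ) (x : EuclideanSpace ℝ (Fin N)) :
    polyEval (p + q) x = polyEval p x + polyEval q x := by simp [polyEval]

theorem polyEval_mul {N : ℕ} (p q : MvPolynomial (Fin N) ℝ) (x : EuclideanSpace ℝ (Fin N)) :
    polyEval (p * q) x = polyEval p x * polyEval q x := by simp [polyEval]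

theorem polyEval_X {N : ℕ} (i : Fin N) (x : EuclideanSpace ℝ (Fin N)) :
    polyEval (MvPolynomial.X i) x = x i := by simp [polyEval]

theorem polyEval_sum {N : ℕ} {ι : Type*} (s : Finset ι) (p : ι → MvPolynomial (Fin N) ℝ)
    (x : EuclideanSpace ℝ (Fin N)) : polyEval (∑ i ∈ s, p i) x = ∑ i ∈ s, polyEval (p i) x := by
  simp [polyEval]

theorem polyEval_normSqPoly {N : ℕ} (x : EuclideanSpace ℝ (Fin N)) :
    polyEval (normSqPoly N) x = ‖x‖ ^ 2 := by
  rw [EuclideanSpace.real_norm_sq_eq]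
  simp [polyEval, normSqPoly]

theorem contDiff_polyEval {N : ℕ} (p : MvPolynomial (Fin N) ℝ) : ContDiff ℝ ∞ (polyEval p) := by
  induction p using MvPolynomial.induction_on with
  | C a =>
    have : polyEval (MvPolynomial.C a : MvPolynomial (Fin N) ℝ) = fun _ => a := by
      ext x; simp [polyEval]
    rw [this]
    exact contDiff_const
  | add p q hp hq => simpa only [← polyEval_add] using! hp.add hq
  | mul_X p i hp =>
    have : polyEval (p * MvPolynomial.X i) = fun x => polyEval p x * x i := by
      ext x
      rw [polyEval_mul, polyEval_X]
    rw [this]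
    exact hp.mul (EuclideanSpace.proj i : EuclideanSpace ℝ (Fin N) →L[ℝ] ℝ).contDiff

theorem fderiv_polyEval {N : ℕ} (p : MvPolynomial (Fin N) ℝ) (x : EuclideanSpace ℝ (Fin N))
    (i : Fin N) :
    fderiv ℝ (polyEval p) x (EuclideanSpace.single i 1) = polyEval (MvPolynomial.pderiv i p) x := by
  have hd : ∀ p : MvPolynomial (Fin N) ℝ, DifferentiableAt ℝ (polyEval p) x := fun p =>
    (contDiff_polyEval p).differentiable (by simp) x
  induction p using MvPolynomial.induction_on with
  | C a =>
    have : polyEval (MvPolynomial.C a : MvPolynomial (Fin N) ℝ) = fun _ => a := by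
      ext x; simp [polyEval]
    rw [this]
    simp [polyEval]
  | add p q hp hq =>
    have : polyEval (p + q) = fun x => polyEval p x + polyEval q x := by
      ext x; rw [polyEval_add]
    rw [this, fderiv_fun_add (hd p) (hd q), map_add, polyEval_add, ← hp, ← hq]
    rfl
  | mul_X p j hp =>
    have : polyEval (p * MvPolynomial.X j) = fun x => polyEval p x * x j := by
      ext x
      rw [polyEval_mul, polyEval_X]
    have hj : HasFDerivAt (fun x : EuclideanSpace ℝ (Fin N) => x j)
        (EuclideanSpace.proj j : EuclideanSpace ℝ (Fin N) →L[ℝ] ℝ) x :=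
      (EuclideanSpace.proj j : EuclideanSpace ℝ (Fin N) →L[ℝ] ℝ).hasFDerivAt
    rw [this, ((hd p).hasFDerivAt.fun_mul hj).fderiv, MvPolynomial.pderiv_mul, polyEval_add,
      polyEval_mul, polyEval_mul, polyEval_X, ← hp, MvPolynomial.pderiv_X]
    by_cases h : i = j
    · subst h
      simp [polyEval]
      ring
    · simp [polyEval, Ne.symm h]
      ring

end PolyEval

/-! ### Smooth cutoffs of width of order `1/n`. -/

section Cutoff

/-- A smooth step of width of order `1 / n` near the point `c`. -/
def smoothStep (c d : ℝ) (n : ℕ) (s : ℝ) : ℝ := Real.smoothTransition (n * (s - c) + d)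

theorem contDiff_smoothStep (c d : ℝ) (n : ℕ) : ContDiff ℝ ∞ (smoothStep c d n) :=
  Real.smoothTransition.contDiff.comp (by fun_prop)

theorem abs_smoothStep_le (c d : ℝ) (n : ℕ) (s : ℝ) : |smoothStep c d n s| ≤ 1 := by
  rw [smoothStep, abs_of_nonneg (Real.smoothTransition.nonneg _)]
  exact Real.smoothTransition.le_one _

theorem deriv_smoothTransition_of_neg {x : ℝ} (hx : x < 0) :
    deriv Real.smoothTransition x = 0 := by
  have : Real.smoothTransition =ᶠ[nhds x] fun _ => 0 := by
    filter_upwards [gt_mem_nhds hx] with w hw using Real.smoothTransition.zero_of_nonpos hw.le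
  rw [this.deriv_eq, deriv_const]

theorem deriv_smoothTransition_of_one_lt {x : ℝ} (hx : 1 < x) :
    deriv Real.smoothTransition x = 0 := by
  have : Real.smoothTransition =ᶠ[nhds x] fun _ => 1 := by
    filter_upwards [lt_mem_nhds hx] with w hw using Real.smoothTransition.one_of_one_le hw.le
  rw [this.deriv_eq, deriv_const]

theorem deriv_smoothStep (c d : ℝ) (n : ℕ) (s : ℝ) :
    deriv (smoothStep c d n) s = n * deriv Real.smoothTransition (n * (s - c) + d) := by
  have h1 : HasDerivAt (fun s : ℝ => n * (s - c) + d) n s :=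
    ((((hasDerivAt_id' s).sub_const c).const_mul (n : ℝ)).add_const d).congr_deriv (by simp)
  have h2 := (Real.smoothTransition.contDiff (n := 1)).differentiable (by simp) (n * (s - c) + d)
  exact (h2.hasDerivAt.comp s h1).deriv.trans (mul_comm _ _)

/-- The derivative has size of order `n`, but only where `|s - c|` is of order `1/n`. In the
variable `x = n(s - c) + d` the product is `|x - d|` times a fixed function vanishing off `[0, 1]`,
so the bound does not depend on `n`. -/
theorem exists_abs_sub_mul_deriv_smoothStep_le (c d : ℝ) :
    ∃ C, 0 ≤ C ∧ ∀ n s, |s - c| * |deriv (smoothStep c d n) s| ≤ C := by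
  have hc : Continuous fun x : ℝ => |x - d| * |deriv Real.smoothTransition x| := by
    have := (Real.smoothTransition.contDiff (n := 1)).continuous_deriv le_rfl
    fun_prop
  obtain ⟨C, hC⟩ := (isCompact_Icc (a := (0 : ℝ)) (b := 1)).exists_bound_of_continuousOn
    hc.continuousOn
  refine ⟨max C 0, le_max_right _ _, fun n s => ?_⟩
  have e : |s - c| * |deriv (smoothStep c d n) s|
      = |(n * (s - c) + d) - d| * |deriv Real.smoothTransition (n * (s - c) + d)| := by
    rw [deriv_smoothStep, abs_mul, add_sub_cancel_right, abs_mul]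
    ring
  rw [e]
  set x := n * (s - c) + d
  rcases lt_or_ge x 0 with h | h
  · simp [deriv_smoothTransition_of_neg h]
  rcases lt_or_ge 1 x with h' | h'
  · simp [deriv_smoothTransition_of_one_lt h']
  · exact ((le_abs_self _).trans (hC x ⟨h, h'⟩)).trans (le_max_left _ _)

theorem eventually_smoothStep_of_gt {c d s : ℝ} (hs : c < s) :
    ∀ᶠ n in Filter.atTop, smoothStep c d n s = 1 ∧ deriv (smoothStep c d n) s = 0 := by
  have h : Filter.Tendsto (fun n : ℕ => (n : ℝ) * (s - c) + d) Filter.atTop Filter.atTop :=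
    Filter.tendsto_atTop_add_const_right _ _
      (tendsto_natCast_atTop_atTop.atTop_mul_const (sub_pos.2 hs))
  filter_upwards [h.eventually_gt_atTop 1] with n hn
  rw [deriv_smoothStep, deriv_smoothTransition_of_one_lt hn, mul_zero]
  exact ⟨Real.smoothTransition.one_of_one_le hn.le, rfl⟩

theorem smoothStep_of_neg {c d s : ℝ} {n : ℕ} (hn : n * (s - c) + d < 0) :
    smoothStep c d n s = 0 ∧ deriv (smoothStep c d n) s = 0 := by
  rw [deriv_smoothStep, deriv_smoothTransition_of_neg hn, mul_zero]
  exact ⟨Real.smoothTransition.zero_of_nonpos hn.le, rfl⟩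

theorem eventually_smoothStep_of_lt {c d s : ℝ} (hs : s < c) :
    ∀ᶠ n in Filter.atTop, smoothStep c d n s = 0 ∧ deriv (smoothStep c d n) s = 0 := by
  have h : Filter.Tendsto (fun n : ℕ => (n : ℝ) * (s - c) + d) Filter.atTop Filter.atBot :=
    Filter.tendsto_atBot_add_const_right _ _
      (tendsto_natCast_atTop_atTop.atTop_mul_const_of_neg (sub_neg.2 hs))
  filter_upwards [h.eventually_lt_atBot 0] with n hn using smoothStep_of_neg hn

/-- Combined with the previous bound, it keeps the product of `D` with the derivative of the cutoff
bounded as `n` grows. -/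
theorem exists_abs_le_mul_abs_sub {D : ℝ → ℝ} (hD : ContDiff ℝ ∞ D) {c : ℝ} (hc : D c = 0) :
    ∃ L, 0 ≤ L ∧ ∀ s ∈ Set.Icc (0 : ℝ) 1, |D s| ≤ L * |s - c| := by
  obtain ⟨L, hL⟩ := (isCompact_Icc (a := min 0 c) (b := max 1 c)).exists_bound_of_continuousOn
    (hD.continuous_deriv (by simp)).continuousOn
  refine ⟨max L 0, le_max_right _ _, fun s hs => ?_⟩
  have := (convex_Icc (min 0 c) (max 1 c)).norm_image_sub_le_of_norm_deriv_le
    (fun x _ => hD.differentiable (by simp) x) (fun x hx => (hL x hx).trans (le_max_left L 0))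
    (x := c) (y := s) ⟨min_le_right _ _, le_max_right _ _⟩
    ⟨(min_le_left _ _).trans hs.1, hs.2.trans (le_max_left _ _)⟩
  simpa [hc] using this

theorem exists_abs_le_Icc {T : ℝ → ℝ} (hT : Continuous T) :
    ∃ C, 0 ≤ C ∧ ∀ s ∈ Set.Icc (0 : ℝ) 1, |T s| ≤ C := by
  obtain ⟨C, hC⟩ := (isCompact_Icc (a := (0 : ℝ)) (b := 1)).exists_bound_of_continuousOn
    hT.continuousOn
  exact ⟨max C 0, le_max_right _ _, fun s hs => (hC s hs).trans (le_max_left _ _)⟩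

end Cutoff

/-! ### Bounded functions on the ball and dominated convergence. -/

section BoundedOnBall

/-- A measurable function that is bounded on the unit ball. -/
structure IsBoundedOnBall {N : ℕ} (F : EuclideanSpace ℝ (Fin N) → ℝ) : Prop where
  measurable : Measurable F
  bound : ∃ C, 0 ≤ C ∧ ∀ x ∈ unitBall N, |F x| ≤ C

variable {N : ℕ} {F G : EuclideanSpace ℝ (Fin N) → ℝ}

theorem Continuous.isBoundedOnBall (hF : Continuous F) : IsBoundedOnBall F := by
  refine ⟨hF.measurable, ?_⟩
  obtain ⟨C, hC⟩ := (isCompact_closedBall (0 : EuclideanSpace ℝ (Fin N)) 1)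
    |>.exists_bound_of_continuousOn hF.continuousOn
  exact ⟨max C 0, le_max_right _ _, fun x hx =>
    (hC x (Metric.ball_subset_closedBall hx)).trans (le_max_left _ _)⟩

theorem IsBoundedOnBall.add (hF : IsBoundedOnBall F) (hG : IsBoundedOnBall G) :
    IsBoundedOnBall fun x => F x + G x := by
  obtain ⟨A, hA0, hA⟩ := hF.bound
  obtain ⟨B, hB0, hB⟩ := hG.bound
  exact ⟨hF.measurable.add hG.measurable, A + B, by positivity, fun x hx =>
    (abs_add_le _ _).trans (add_le_add (hA x hx) (hB x hx))⟩

theorem IsBoundedOnBall.mul (hF : IsBoundedOnBall F) (hG : IsBoundedOnBall G) :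
    IsBoundedOnBall fun x => F x * G x := by
  obtain ⟨A, hA0, hA⟩ := hF.bound
  obtain ⟨B, hB0, hB⟩ := hG.bound
  refine ⟨hF.measurable.mul hG.measurable, A * B, by positivity, fun x hx => ?_⟩
  rw [abs_mul]
  exact mul_le_mul (hA x hx) (hB x hx) (abs_nonneg _) hA0

theorem isBoundedOnBall_const (a : ℝ) : IsBoundedOnBall fun _ : EuclideanSpace ℝ (Fin N) => a :=
  continuous_const.isBoundedOnBall

theorem norm_sq_mem_Icc {x : EuclideanSpace ℝ (Fin N)} (hx : x ∈ unitBall N) :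
    ‖x‖ ^ 2 ∈ Set.Icc (0 : ℝ) 1 := by
  have : ‖x‖ < 1 := by simpa [unitBall] using hx
  exact ⟨by positivity, by nlinarith [norm_nonneg x]⟩

theorem norm_sq_lt_one {x : EuclideanSpace ℝ (Fin N)} (hx : x ∈ unitBall N) : ‖x‖ ^ 2 < 1 := by
  have : ‖x‖ < 1 := by simpa [unitBall] using hx
  nlinarith [norm_nonneg x]

theorem isBoundedOnBall_ite {S T : ℝ → ℝ} (hS : Continuous S) (hT : Continuous T) (c : ℝ) :
    IsBoundedOnBall fun x : EuclideanSpace ℝ (Fin N) =>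
      if ‖x‖ ^ 2 ≤ c then S (‖x‖ ^ 2) else T (‖x‖ ^ 2) := by
  refine ⟨Measurable.ite (measurableSet_le (by fun_prop) measurable_const)
    (by fun_prop) (by fun_prop), ?_⟩
  obtain ⟨A, hA0, hA⟩ := exists_abs_le_Icc hS
  obtain ⟨B, hB0, hB⟩ := exists_abs_le_Icc hT
  refine ⟨A + B, by positivity, fun x hx => ?_⟩
  split_ifs
  · linarith [hA _ (norm_sq_mem_Icc hx)]
  · linarith [hB _ (norm_sq_mem_Icc hx)]

theorem measurableSet_unitBall (N : ℕ) : MeasurableSet (unitBall N) := Metric.isOpen_ball.measurableSet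

instance isFiniteMeasure_restrict_unitBall (N : ℕ) :
    IsFiniteMeasure (volume.restrict (unitBall N)) :=
  ⟨by rw [Measure.restrict_apply_univ]; exact measure_ball_lt_top⟩

theorem IsBoundedOnBall.ae_bound (hF : IsBoundedOnBall F) :
    ∃ C, ∀ᵐ x ∂(volume.restrict (unitBall N)), ‖F x‖ ≤ C := by
  obtain ⟨C, -, hC⟩ := hF.bound
  exact ⟨C, (ae_restrict_iff' (measurableSet_unitBall N)).2 (.of_forall hC)⟩

theorem MeasureTheory.Integrable.mul_isBoundedOnBall {v : EuclideanSpace ℝ (Fin N) → ℝ}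
    (hv : Integrable v (volume.restrict (unitBall N))) (hF : IsBoundedOnBall F) :
    Integrable (fun x => v x * F x) (volume.restrict (unitBall N)) := by
  obtain ⟨C, hC⟩ := hF.ae_bound
  exact hv.mul_bdd hF.measurable.aestronglyMeasurable hC

theorem IsBoundedOnBall.memLp (hF : IsBoundedOnBall F) :
    MemLp F 2 (volume.restrict (unitBall N)) := by
  obtain ⟨C, hC⟩ := hF.ae_bound
  exact MemLp.of_bound hF.measurable.aestronglyMeasurable C hC

/-- The limit passage used for all cutoffs: `v` is merely integrable, so uniformly bounded pointwise
convergence of the other factor is what is needed. -/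
theorem tendsto_integral_mul_of_bounded {v : EuclideanSpace ℝ (Fin N) → ℝ}
    (hv : Integrable v (volume.restrict (unitBall N)))
    {F : ℕ → EuclideanSpace ℝ (Fin N) → ℝ} (hF : ∀ n, Measurable (F n)) (C : ℝ)
    (hC : ∀ n, ∀ x ∈ unitBall N, |F n x| ≤ C)
    (hlim : ∀ x ∈ unitBall N, Filter.Tendsto (fun n => F n x) Filter.atTop (nhds (G x))) :
    Filter.Tendsto (fun n => ∫ x in unitBall N, v x * F n x) Filter.atTop
      (nhds (∫ x in unitBall N, v x * G x)) := by
  refine tendsto_integral_of_dominated_convergence (fun x => |v x| * C)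
    (fun n => hv.aestronglyMeasurable.mul (hF n).aestronglyMeasurable)
    (hv.abs.mul_const C) (fun n => ?_) ?_
  · refine (ae_restrict_iff' (measurableSet_unitBall N)).2 (.of_forall fun x hx => ?_)
    rw [norm_mul]
    exact mul_le_mul_of_nonneg_left (hC n x hx) (abs_nonneg _)
  · exact (ae_restrict_iff' (measurableSet_unitBall N)).2 (.of_forall fun x hx =>
      (hlim x hx).const_mul _)

end BoundedOnBall

/-! ### Weak gradients tested with radial functions times polynomials. -/

section Green

variable {N : ℕ} {v : EuclideanSpace ℝ (Fin N) → ℝ}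
  {h : EuclideanSpace ℝ (Fin N) → EuclideanSpace ℝ (Fin N)}

theorem HasH1Gradient.integrable (hv : HasH1Gradient (unitBall N) v h) :
    Integrable v (volume.restrict (unitBall N)) := hv.memLp.integrable (by norm_num)

theorem memLp_apply {μ : Measure (EuclideanSpace ℝ (Fin N))} (hh : MemLp h 2 μ) (i : Fin N) :
    MemLp (fun x => h x i) 2 μ :=
  (EuclideanSpace.proj i : EuclideanSpace ℝ (Fin N) →L[ℝ] ℝ).comp_memLp' hh

theorem HasH1Gradient.integrable_apply (hv : HasH1Gradient (unitBall N) v h) (i : Fin N) :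
    Integrable (fun x => h x i) (volume.restrict (unitBall N)) :=
  (memLp_apply hv.memLp_grad i).integrable (by norm_num)

theorem hasFDerivAt_radial_mul {T : ℝ → ℝ} {T' : ℝ} {x : EuclideanSpace ℝ (Fin N)}
    (hT : HasDerivAt T T' (‖x‖ ^ 2)) (p : MvPolynomial (Fin N) ℝ) :
    HasFDerivAt (fun x => T (‖x‖ ^ 2) * polyEval p x)
      (T (‖x‖ ^ 2) • fderiv ℝ (polyEval p) x
        + polyEval p x • (T' • (2 • innerSL ℝ x))) x :=
  (hT.comp_hasFDerivAt x (hasStrictFDerivAt_norm_sq x).hasFDerivAt).fun_mul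
    ((contDiff_polyEval p).differentiable (by simp) x).hasFDerivAt

theorem fderiv_radial_mul_apply {T : ℝ → ℝ} {T' : ℝ} {x : EuclideanSpace ℝ (Fin N)}
    (hT : HasDerivAt T T' (‖x‖ ^ 2)) (p : MvPolynomial (Fin N) ℝ) (i : Fin N) :
    fderiv ℝ (fun x => T (‖x‖ ^ 2) * polyEval p x) x (EuclideanSpace.single i 1)
      = T' * (2 * x i * polyEval p x) + T (‖x‖ ^ 2) * polyEval (MvPolynomial.pderiv i p) x := by
  rw [(hasFDerivAt_radial_mul hT p).fderiv, ← fderiv_polyEval]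
  simp [EuclideanSpace.inner_single_right]
  ring

/-- The weak formulation with a test function that is a smooth radial function times a
polynomial. -/
theorem HasH1Gradient.integral_radial (hv : HasH1Gradient (unitBall N) v h) {T : ℝ → ℝ}
    (hT : ContDiff ℝ ∞ T) {δ : ℝ} (hδ : 0 < δ) (hT0 : ∀ s, 1 - δ ≤ s → T s = 0)
    (p : MvPolynomial (Fin N) ℝ) (i : Fin N) :
    ∫ x in unitBall N, h x i * (T (‖x‖ ^ 2) * polyEval p x)
      = -∫ x in unitBall N, v x * (deriv T (‖x‖ ^ 2) * (2 * x i * polyEval p x)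
        + T (‖x‖ ^ 2) * polyEval (MvPolynomial.pderiv i p) x) := by
  have hsub : tsupport (fun x : EuclideanSpace ℝ (Fin N) => T (‖x‖ ^ 2) * polyEval p x)
      ⊆ {x | ‖x‖ ^ 2 ≤ 1 - δ} := by
    refine closure_minimal (fun x hx => ?_) (isClosed_le (by fun_prop) continuous_const)
    by_contra hlt
    exact hx (by simp [hT0 _ (not_le.1 hlt).le])
  have hball : {x : EuclideanSpace ℝ (Fin N) | ‖x‖ ^ 2 ≤ 1 - δ} ⊆ unitBall N := by
    intro x hx
    have hx : ‖x‖ ^ 2 ≤ 1 - δ := hx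
    simp only [unitBall, mem_ball_zero_iff]
    nlinarith [norm_nonneg x]
  have ht : IsTestFunctionOn (unitBall N)
      (fun x : EuclideanSpace ℝ (Fin N) => T (‖x‖ ^ 2) * polyEval p x) := by
    refine ⟨(hT.comp (contDiff_norm_sq ℝ)).mul (contDiff_polyEval p), ?_, hsub.trans hball⟩
    exact (isCompact_closedBall (0 : EuclideanSpace ℝ (Fin N)) 1).of_isClosed_subset
      (isClosed_tsupport _) ((hsub.trans hball).trans Metric.ball_subset_closedBall)
  have := hv.integral_eq _ ht i
  rw [eq_neg_iff_add_eq_zero, add_comm, ← eq_neg_iff_add_eq_zero, ← this]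
  congr 1
  ext x
  rw [fderiv_radial_mul_apply (hT.differentiable (by simp) _).hasDerivAt]

/-- The weak formulation with a test function that is a piecewise smooth radial function times a
polynomial. -/
theorem HasH1Gradient.integral_radial_ite (hv : HasH1Gradient (unitBall N) v h) {S T : ℝ → ℝ}
    (hS : ContDiff ℝ ∞ S) (hT : ContDiff ℝ ∞ T) {c : ℝ} (hST : S c = T c) {δ : ℝ} (hδ : 0 < δ)
    (hS0 : ∀ s, 1 - δ ≤ s → S s = 0) (hT0 : ∀ s, 1 - δ ≤ s → T s = 0)
    (p : MvPolynomial (Fin N) ℝ) (i : Fin N) :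
    ∫ x in unitBall N, h x i *
        ((if ‖x‖ ^ 2 ≤ c then S (‖x‖ ^ 2) else T (‖x‖ ^ 2)) * polyEval p x)
      = -∫ x in unitBall N, v x *
        ((if ‖x‖ ^ 2 ≤ c then deriv S (‖x‖ ^ 2) else deriv T (‖x‖ ^ 2)) * (2 * x i * polyEval p x)
        + (if ‖x‖ ^ 2 ≤ c then S (‖x‖ ^ 2) else T (‖x‖ ^ 2))
          * polyEval (MvPolynomial.pderiv i p) x) := by
  -- The shift `-1` puts the whole transition strictly to the right of `c`. Hence `κ n` and its
  -- derivative vanish for all `s ≤ c`, including `s = c`, in agreement with the branch chosen in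
  -- `if s ≤ c`.
  set κ := smoothStep c (-1)
  set R : ℕ → ℝ → ℝ := fun n s => S s + κ n s * (T s - S s)
  have hκ : ∀ n, ContDiff ℝ ∞ (κ n) := contDiff_smoothStep c (-1)
  have hR : ∀ n, ContDiff ℝ ∞ (R n) := fun n => hS.add ((hκ n).mul (hT.sub hS))
  have hR' : ∀ n s, deriv (R n) s
      = deriv S s + (deriv (κ n) s * (T s - S s) + κ n s * (deriv T s - deriv S s)) := by
    intro n s
    have d : ∀ {f : ℝ → ℝ}, ContDiff ℝ ∞ f → HasDerivAt f (deriv f s) s := fun hf =>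
      (hf.differentiable (by simp) s).hasDerivAt
    exact ((d hS).add ((d (hκ n)).mul ((d hT).sub (d hS)))).deriv
  have hneg : ∀ n s, s ≤ c → κ n s = 0 ∧ deriv (κ n) s = 0 := by
    intro n s hs
    refine smoothStep_of_neg ?_
    nlinarith [mul_nonneg (Nat.cast_nonneg (α := ℝ) n) (sub_nonneg.2 hs)]
  have hlim : ∀ s, Filter.Tendsto (fun n => R n s) Filter.atTop
      (nhds (if s ≤ c then S s else T s)) := by
    intro s
    refine tendsto_const_nhds.congr' ?_
    split_ifs with hs
    · exact .of_forall fun n => by simp [R, (hneg n s hs).1]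
    · filter_upwards [eventually_smoothStep_of_gt (d := -1) (not_le.1 hs)] with n hn
      simp [R, κ, hn.1]
  have hlim' : ∀ s, Filter.Tendsto (fun n => deriv (R n) s) Filter.atTop
      (nhds (if s ≤ c then deriv S s else deriv T s)) := by
    intro s
    refine tendsto_const_nhds.congr' ?_
    split_ifs with hs
    · exact .of_forall fun n => by simp [hR', (hneg n s hs).1, (hneg n s hs).2]
    · filter_upwards [eventually_smoothStep_of_gt (d := -1) (not_le.1 hs)] with n hn
      simp [hR', κ, hn.1, hn.2]
  obtain ⟨A, hA0, hA⟩ := exists_abs_le_Icc hS.continuous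
  obtain ⟨B, hB0, hB⟩ := exists_abs_le_Icc (hT.sub hS).continuous
  obtain ⟨A', hA'0, hA'⟩ := exists_abs_le_Icc (hS.continuous_deriv (by simp))
  obtain ⟨B', hB'0, hB'⟩ := exists_abs_le_Icc
    ((hT.continuous_deriv (by simp)).sub (hS.continuous_deriv (by simp)))
  -- Continuity at the interface enters here: `T - S` vanishes at `c` and compensates the growth of
  -- the derivative of `κ n`.
  obtain ⟨L, hL0, hL⟩ := exists_abs_le_mul_abs_sub (hT.sub hS) (c := c) (by simp [hST])
  obtain ⟨K, hK0, hK⟩ := exists_abs_sub_mul_deriv_smoothStep_le c (-1)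
  have hRb : ∀ n, ∀ s ∈ Set.Icc (0 : ℝ) 1, |R n s| ≤ A + B := by
    intro n s hs
    refine (abs_add_le _ _).trans (add_le_add (hA s hs) ?_)
    rw [abs_mul]
    calc |κ n s| * |T s - S s| ≤ 1 * B :=
          mul_le_mul (abs_smoothStep_le _ _ _ _) (hB s hs) (abs_nonneg _) zero_le_one
      _ = B := one_mul B
  have hRb' : ∀ n, ∀ s ∈ Set.Icc (0 : ℝ) 1, |deriv (R n) s| ≤ A' + (L * K + B') := by
    intro n s hs
    rw [hR']
    refine (abs_add_le _ _).trans (add_le_add (hA' s hs)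
      ((abs_add_le _ _).trans (add_le_add ?_ ?_)))
    · rw [abs_mul]
      calc |deriv (κ n) s| * |T s - S s| ≤ |deriv (κ n) s| * (L * |s - c|) :=
            mul_le_mul_of_nonneg_left (hL s hs) (abs_nonneg _)
        _ = L * (|s - c| * |deriv (κ n) s|) := by ring
        _ ≤ L * K := mul_le_mul_of_nonneg_left (hK n s) hL0
    · rw [abs_mul]
      calc |κ n s| * |deriv T s - deriv S s| ≤ 1 * B' :=
            mul_le_mul (abs_smoothStep_le _ _ _ _) (hB' s hs) (abs_nonneg _) zero_le_one
        _ = B' := one_mul B'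
  have hp : ∀ q : MvPolynomial (Fin N) ℝ, Continuous (polyEval q) := fun q =>
    (contDiff_polyEval q).continuous
  have hRc : ∀ n, Continuous (R n) := fun n => (hR n).continuous
  have hRc' : ∀ n, Continuous (deriv (R n)) := fun n => (hR n).continuous_deriv (by simp)
  have hxi : Continuous fun x : EuclideanSpace ℝ (Fin N) => 2 * x i * polyEval p x := by
    have := hp p
    fun_prop
  obtain ⟨P, hP0, hP⟩ := (hp p).isBoundedOnBall.bound
  obtain ⟨P', hP'0, hP'⟩ := (hp (MvPolynomial.pderiv i p)).isBoundedOnBall.bound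
  obtain ⟨Q, hQ0, hQ⟩ := hxi.isBoundedOnBall.bound
  have key : ∀ n, _ := fun n => hv.integral_radial (hR n) hδ
    (fun s hs => by simp [R, hS0 s hs, hT0 s hs]) p i
  have l1 := tendsto_integral_mul_of_bounded (hv.integrable_apply i)
    (F := fun n x => R n (‖x‖ ^ 2) * polyEval p x)
    (G := fun x => (if ‖x‖ ^ 2 ≤ c then S (‖x‖ ^ 2) else T (‖x‖ ^ 2)) * polyEval p x)
    (fun n => by
      have := hRc n
      have := hp p
      exact Continuous.measurable (by fun_prop)) ((A + B) * P)
    (fun n x hx => by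
      rw [abs_mul]
      exact mul_le_mul (hRb n _ (norm_sq_mem_Icc hx)) (hP x hx) (abs_nonneg _) (by positivity))
    (fun x hx => (hlim _).mul_const _)
  have l2 := tendsto_integral_mul_of_bounded hv.integrable
    (F := fun n x => deriv (R n) (‖x‖ ^ 2) * (2 * x i * polyEval p x)
        + R n (‖x‖ ^ 2) * polyEval (MvPolynomial.pderiv i p) x)
    (G := fun x => (if ‖x‖ ^ 2 ≤ c then deriv S (‖x‖ ^ 2) else deriv T (‖x‖ ^ 2))
        * (2 * x i * polyEval p x)
        + (if ‖x‖ ^ 2 ≤ c then S (‖x‖ ^ 2) else T (‖x‖ ^ 2))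
          * polyEval (MvPolynomial.pderiv i p) x)
    (fun n => by
      have := hRc n
      have := hRc' n
      have := hp (MvPolynomial.pderiv i p)
      exact Continuous.measurable (by fun_prop)) ((A' + (L * K + B')) * Q + (A + B) * P')
    (fun n x hx => by
      refine (abs_add_le _ _).trans (add_le_add ?_ ?_)
      · rw [abs_mul]
        exact mul_le_mul (hRb' n _ (norm_sq_mem_Icc hx)) (hQ x hx) (abs_nonneg _) (by positivity)
      · rw [abs_mul]
        exact mul_le_mul (hRb n _ (norm_sq_mem_Icc hx)) (hP' x hx) (abs_nonneg _) (by positivity))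
    (fun x hx => ((hlim' _).mul_const _).add ((hlim _).mul_const _))
  exact tendsto_nhds_unique l1 (l2.neg.congr fun n => (key n).symm)

end Green

/-! ### Green's formula for `f(|x|²) H(x)`. -/

section RadialField

/-- A pair of smooth functions that fit together to a `C¹` function at `c ∈ (0, 1)`, whose flux
`2 f'(1) + l f(1)` vanishes. -/
structure IsNeumannProfile (l : ℕ) (c : ℝ) (S T : ℝ → ℝ) : Prop where
  pos : 0 < c
  lt_one : c < 1
  contDiff_left : ContDiff ℝ ∞ S
  contDiff_right : ContDiff ℝ ∞ T
  eq : S c = T c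
  deriv_eq : deriv S c = deriv T c
  flux : 2 * deriv T 1 + l * T 1 = 0

/-- The `i`-th component of the gradient of `f(|x|²) H(x)`, where `f` is `S` on `(-∞, c]`
and `T` on `(c, ∞)`. -/
def profileGrad {N : ℕ} (c : ℝ) (S T : ℝ → ℝ) (H : MvPolynomial (Fin N) ℝ) (i : Fin N)
    (x : EuclideanSpace ℝ (Fin N)) : ℝ :=
  (if ‖x‖ ^ 2 ≤ c then deriv S (‖x‖ ^ 2) else deriv T (‖x‖ ^ 2)) * (2 * x i * polyEval H x)
    + (if ‖x‖ ^ 2 ≤ c then S (‖x‖ ^ 2) else T (‖x‖ ^ 2))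
      * polyEval (MvPolynomial.pderiv i H) x

/-- The Laplacian of `f(|x|²) H(x)`, divided by `H(x)`, for homogeneous harmonic `H` of degree `l`,
as a function of `s = |x|²`. -/
def radialLaplacian (N l : ℕ) (S : ℝ → ℝ) (s : ℝ) : ℝ :=
  4 * s * deriv (deriv S) s + 2 * (N + 2 * l) * deriv S s

variable {N l : ℕ} {c : ℝ} {S T : ℝ → ℝ} {H : MvPolynomial (Fin N) ℝ}

theorem ContDiff.deriv_infty (hS : ContDiff ℝ ∞ S) : ContDiff ℝ ∞ (deriv S) :=
  ContDiff.deriv' (by simpa using hS)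

theorem isBoundedOnBall_polyEval (p : MvPolynomial (Fin N) ℝ) : IsBoundedOnBall (polyEval p) :=
  (contDiff_polyEval p).continuous.isBoundedOnBall

theorem isBoundedOnBall_apply (i : Fin N) :
    IsBoundedOnBall fun x : EuclideanSpace ℝ (Fin N) => x i :=
  Continuous.isBoundedOnBall (by fun_prop)

theorem isBoundedOnBall_profileGrad (hS : ContDiff ℝ ∞ S) (hT : ContDiff ℝ ∞ T) (c : ℝ)
    (H : MvPolynomial (Fin N) ℝ) (i : Fin N) : IsBoundedOnBall (profileGrad c S T H i) :=
  ((isBoundedOnBall_ite (hS.continuous_deriv (by simp)) (hT.continuous_deriv (by simp)) c).mul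
    (((isBoundedOnBall_const 2).mul (isBoundedOnBall_apply i)).mul
      (isBoundedOnBall_polyEval H))).add
  ((isBoundedOnBall_ite hS.continuous hT.continuous c).mul (isBoundedOnBall_polyEval _))

theorem sum_apply_sq (x : EuclideanSpace ℝ (Fin N)) : ∑ i, x i * x i = ‖x‖ ^ 2 := by
  rw [EuclideanSpace.real_norm_sq_eq]
  exact Finset.sum_congr rfl fun i _ => (sq _).symm

theorem sum_apply_mul_polyEval_pderiv (hH : H.IsHomogeneous l) (x : EuclideanSpace ℝ (Fin N)) :
    ∑ i, x i * polyEval (MvPolynomial.pderiv i H) x = l * polyEval H x := by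
  have := congrArg (fun p => polyEval p x) hH.sum_X_mul_pderiv
  simpa [polyEval_sum, polyEval_mul, polyEval_X, polyEval] using this

theorem sum_polyEval_pderiv_pderiv (hH : polyLaplacian N H = 0) (x : EuclideanSpace ℝ (Fin N)) :
    ∑ i, polyEval (MvPolynomial.pderiv i (MvPolynomial.pderiv i H)) x = 0 := by
  rw [← polyEval_sum, ← polyLaplacian_apply, hH]
  simp [polyEval]

/-- The divergence of `η(|x|²)` times the gradient of `f(|x|²) H(x)`. -/
theorem sum_divergence (hH : H.IsHomogeneous l) (hH0 : polyLaplacian N H = 0)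
    (x : EuclideanSpace ℝ (Fin N)) (η η' f f' f'' : ℝ) :
    ∑ i, (2 * ((η' * f' + η * f'') * (2 * x i * polyEval (MvPolynomial.X i * H) x)
        + η * f' * polyEval (MvPolynomial.pderiv i (MvPolynomial.X i * H)) x)
      + ((η' * f + η * f') * (2 * x i * polyEval (MvPolynomial.pderiv i H) x)
        + η * f * polyEval (MvPolynomial.pderiv i (MvPolynomial.pderiv i H)) x))
      = η * ((4 * ‖x‖ ^ 2 * f'' + 2 * (N + 2 * l) * f') * polyEval H x)
        + η' * (2 * ‖x‖ ^ 2 * f' + l * f) * (2 * polyEval H x) := by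
  have e : ∀ i, (2 * ((η' * f' + η * f'') * (2 * x i * polyEval (MvPolynomial.X i * H) x)
        + η * f' * polyEval (MvPolynomial.pderiv i (MvPolynomial.X i * H)) x)
      + ((η' * f + η * f') * (2 * x i * polyEval (MvPolynomial.pderiv i H) x)
        + η * f * polyEval (MvPolynomial.pderiv i (MvPolynomial.pderiv i H)) x))
      = 4 * (η' * f' + η * f'') * polyEval H x * (x i * x i) + 2 * η * f' * polyEval H x
        + (2 * η * f' + 2 * (η' * f + η * f')) * (x i * polyEval (MvPolynomial.pderiv i H) x)
        + η * f * polyEval (MvPolynomial.pderiv i (MvPolynomial.pderiv i H)) x := by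
    intro i
    rw [MvPolynomial.pderiv_mul, MvPolynomial.pderiv_X_self, one_mul, polyEval_add, polyEval_mul,
      polyEval_mul, polyEval_X]
    ring
  rw [Finset.sum_congr rfl fun i _ => e i, Finset.sum_add_distrib, Finset.sum_add_distrib,
    Finset.sum_add_distrib, ← Finset.mul_sum, ← Finset.mul_sum, ← Finset.mul_sum,
    ← Finset.mul_sum, sum_apply_sq,
    sum_apply_mul_polyEval_pderiv hH, sum_polyEval_pderiv_pderiv hH0,
    Finset.sum_const, Finset.card_univ, Fintype.card_fin, nsmul_eq_mul]
  ring

/-- The quantity is the factor of `H` in `x · ∇(f(|x|²) H)`. On the outer branch it is Lipschitz and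
vanishes at `1`; on the inner branch `|s - 1| ≥ 1 - c`, so boundedness suffices. -/
theorem IsNeumannProfile.exists_flux_bound (hf : IsNeumannProfile l c S T) :
    ∃ L, 0 ≤ L ∧ ∀ s ∈ Set.Icc (0 : ℝ) 1,
      |2 * s * (if s ≤ c then deriv S s else deriv T s) + l * (if s ≤ c then S s else T s)|
        ≤ L * |s - 1| := by
  have hD : ∀ {f : ℝ → ℝ}, ContDiff ℝ ∞ f → ContDiff ℝ ∞ fun s => 2 * s * deriv f s + l * f s :=
    fun hf => ((contDiff_const.mul contDiff_id).mul hf.deriv_infty).add (contDiff_const.mul hf)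
  obtain ⟨L, hL0, hL⟩ := exists_abs_le_mul_abs_sub (hD hf.contDiff_right) (c := 1)
    (by simpa using hf.flux)
  obtain ⟨K, hK0, hK⟩ := exists_abs_le_Icc (hD hf.contDiff_left).continuous
  have hc : 0 < 1 - c := sub_pos.2 hf.lt_one
  refine ⟨L + K / (1 - c), by positivity, fun s hs => ?_⟩
  split_ifs with h
  · have h1 : 1 - c ≤ |s - 1| := by
      rw [abs_sub_comm]
      exact (by linarith : 1 - c ≤ 1 - s).trans (le_abs_self _)
    calc _ ≤ K := hK s hs
      _ = K / (1 - c) * (1 - c) := by field_simp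
      _ ≤ K / (1 - c) * |s - 1| := by gcongr
      _ ≤ _ := by nlinarith [abs_nonneg (s - 1)]
  · calc _ ≤ L * |s - 1| := hL s hs
      _ ≤ _ := by
        have : 0 ≤ K / (1 - c) := by positivity
        nlinarith [abs_nonneg (s - 1)]

/-- Green's formula for `f(|x|²) H(x)` with vanishing normal derivative against a function
in `H¹` of the ball. -/
theorem IsNeumannProfile.green (hf : IsNeumannProfile l c S T) (hH : H.IsHomogeneous l)
    (hH0 : polyLaplacian N H = 0) {v : EuclideanSpace ℝ (Fin N) → ℝ}
    {h : EuclideanSpace ℝ (Fin N) → EuclideanSpace ℝ (Fin N)}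
    (hv : HasH1Gradient (unitBall N) v h) :
    ∑ i, ∫ x in unitBall N, h x i * profileGrad c S T H i x
      = -∫ x in unitBall N, v x * ((if ‖x‖ ^ 2 ≤ c then radialLaplacian N l S (‖x‖ ^ 2)
          else radialLaplacian N l T (‖x‖ ^ 2)) * polyEval H x) := by
  have hS := hf.contDiff_left
  have hT := hf.contDiff_right
  -- The shift `2` completes the transition before `s = 1`, so `η n = 1 - κ n` vanishes near the
  -- sphere and gives compactly supported test functions. The threshold `1 - 1/(n+1)` used below
  -- also covers `n = 0`.
  set κ := smoothStep 1 2
  set η : ℕ → ℝ → ℝ := fun n s => 1 - κ n s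
  have hκ : ∀ n, ContDiff ℝ ∞ (κ n) := contDiff_smoothStep 1 2
  have hη : ∀ n, ContDiff ℝ ∞ (η n) := fun n => contDiff_const.sub (hκ n)
  have hη' : ∀ n s, deriv (η n) s = -deriv (κ n) s := fun n s => deriv_const_sub 1
  have hηb : ∀ n s, |η n s| ≤ 1 := fun n s => by
    have h1 : 0 ≤ κ n s := Real.smoothTransition.nonneg _
    have h2 : κ n s ≤ 1 := Real.smoothTransition.le_one _
    rw [abs_le]
    constructor <;> simp only [η] <;> linarith
  have hη0 : ∀ n : ℕ, ∀ s, 1 - 1 / ((n : ℝ) + 1) ≤ s → η n s = 0 := fun n s hs => by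
    have : κ n s = 1 := Real.smoothTransition.one_of_one_le (by
      have h1 : (n : ℝ) * (1 - s) ≤ n * (1 / ((n : ℝ) + 1)) := by gcongr; linarith
      have h2 : (n : ℝ) * (1 / ((n : ℝ) + 1)) ≤ 1 := by
        rw [mul_one_div, div_le_one (by positivity)]
        linarith
      nlinarith)
    simp [η, this]
  have hlim : ∀ s, s < 1 → Filter.Tendsto (fun n => η n s) Filter.atTop (nhds 1) := by
    intro s hs
    refine tendsto_const_nhds.congr' ?_
    filter_upwards [eventually_smoothStep_of_lt (d := 2) hs] with n hn
    simp [η, κ, hn.1]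
  have hlim' : ∀ s, s < 1 → Filter.Tendsto (fun n => deriv (η n) s) Filter.atTop (nhds 0) := by
    intro s hs
    refine tendsto_const_nhds.congr' ?_
    filter_upwards [eventually_smoothStep_of_lt (d := 2) hs] with n hn
    simp [hη', κ, hn.2]
  have hmul : ∀ n {g : ℝ → ℝ}, ContDiff ℝ ∞ g → ∀ s,
      deriv (fun s => η n s * g s) s = deriv (η n) s * g s + η n s * deriv g s :=
    fun n g hg s => (((hη n).differentiable (by simp) s).hasDerivAt.mul
      (hg.differentiable (by simp) s).hasDerivAt).deriv
  set f : EuclideanSpace ℝ (Fin N) → ℝ := fun x =>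
    if ‖x‖ ^ 2 ≤ c then S (‖x‖ ^ 2) else T (‖x‖ ^ 2) with hfdef
  set f' : EuclideanSpace ℝ (Fin N) → ℝ := fun x =>
    if ‖x‖ ^ 2 ≤ c then deriv S (‖x‖ ^ 2) else deriv T (‖x‖ ^ 2) with hf'def
  set f'' : EuclideanSpace ℝ (Fin N) → ℝ := fun x =>
    if ‖x‖ ^ 2 ≤ c then deriv (deriv S) (‖x‖ ^ 2) else deriv (deriv T) (‖x‖ ^ 2) with hf''def
  have hfb : IsBoundedOnBall f := isBoundedOnBall_ite hS.continuous hT.continuous c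
  have hfb' : IsBoundedOnBall f' :=
    isBoundedOnBall_ite hS.deriv_infty.continuous hT.deriv_infty.continuous c
  have hfb'' : IsBoundedOnBall f'' :=
    isBoundedOnBall_ite hS.deriv_infty.deriv_infty.continuous
      hT.deriv_infty.deriv_infty.continuous c
  have hηB : ∀ n, IsBoundedOnBall fun x : EuclideanSpace ℝ (Fin N) => η n (‖x‖ ^ 2) := fun n =>
    Continuous.isBoundedOnBall (by have := (hη n).continuous; fun_prop)
  have hηB' : ∀ n, IsBoundedOnBall fun x : EuclideanSpace ℝ (Fin N) => deriv (η n) (‖x‖ ^ 2) :=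
    fun n => Continuous.isBoundedOnBall (by have := (hη n).deriv_infty.continuous; fun_prop)
  have hG : ∀ i, IsBoundedOnBall (profileGrad c S T H i) :=
    isBoundedOnBall_profileGrad hS hT c H
  -- the weak formulation for the two parts of the gradient, cut off near the boundary
  have w1 : ∀ n i, ∫ x in unitBall N, h x i * (η n (‖x‖ ^ 2) * f' x
        * polyEval (MvPolynomial.X i * H) x)
      = -∫ x in unitBall N, v x * ((deriv (η n) (‖x‖ ^ 2) * f' x + η n (‖x‖ ^ 2) * f'' x)
          * (2 * x i * polyEval (MvPolynomial.X i * H) x)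
        + η n (‖x‖ ^ 2) * f' x
          * polyEval (MvPolynomial.pderiv i (MvPolynomial.X i * H)) x) := by
    intro n i
    -- The part `2 f' x_i H` of the gradient is continuous across the interface because the first
    -- derivatives match.
    have := hv.integral_radial_ite ((hη n).mul hS.deriv_infty) ((hη n).mul hT.deriv_infty)
      (c := c) (by simp only [hf.deriv_eq]) (by positivity : 0 < 1 / ((n : ℝ) + 1))
      (fun s hs => by simp [hη0 n s hs]) (fun s hs => by simp [hη0 n s hs])
      (MvPolynomial.X i * H) i
    simp only [hmul n hS.deriv_infty, hmul n hT.deriv_infty] at this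
    simpa only [f', f'', mul_ite, ← ite_add_ite] using this
  have w2 : ∀ n i, ∫ x in unitBall N, h x i * (η n (‖x‖ ^ 2) * f x
        * polyEval (MvPolynomial.pderiv i H) x)
      = -∫ x in unitBall N, v x * ((deriv (η n) (‖x‖ ^ 2) * f x + η n (‖x‖ ^ 2) * f' x)
          * (2 * x i * polyEval (MvPolynomial.pderiv i H) x)
        + η n (‖x‖ ^ 2) * f x
          * polyEval (MvPolynomial.pderiv i (MvPolynomial.pderiv i H)) x) := by
    intro n i
    have := hv.integral_radial_ite ((hη n).mul hS) ((hη n).mul hT)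
      (c := c) (by simp only [hf.eq]) (by positivity : 0 < 1 / ((n : ℝ) + 1))
      (fun s hs => by simp [hη0 n s hs]) (fun s hs => by simp [hη0 n s hs])
      (MvPolynomial.pderiv i H) i
    simp only [hmul n hS, hmul n hT] at this
    simpa only [f, f', mul_ite, ← ite_add_ite] using this
  have hx2 : ∀ i : Fin N, IsBoundedOnBall fun x : EuclideanSpace ℝ (Fin N) => 2 * x i := fun i =>
    (isBoundedOnBall_const 2).mul (isBoundedOnBall_apply i)
  have pe := isBoundedOnBall_polyEval (N := N)
  have hI1 : ∀ n i, IsBoundedOnBall fun x =>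
      (deriv (η n) (‖x‖ ^ 2) * f' x + η n (‖x‖ ^ 2) * f'' x)
          * (2 * x i * polyEval (MvPolynomial.X i * H) x)
        + η n (‖x‖ ^ 2) * f' x
          * polyEval (MvPolynomial.pderiv i (MvPolynomial.X i * H)) x := fun n i =>
    ((((hηB' n).mul hfb').add ((hηB n).mul hfb'')).mul ((hx2 i).mul (pe _))).add
      (((hηB n).mul hfb').mul (pe _))
  have hI2 : ∀ n i, IsBoundedOnBall fun x =>
      (deriv (η n) (‖x‖ ^ 2) * f x + η n (‖x‖ ^ 2) * f' x)
          * (2 * x i * polyEval (MvPolynomial.pderiv i H) x)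
        + η n (‖x‖ ^ 2) * f x
          * polyEval (MvPolynomial.pderiv i (MvPolynomial.pderiv i H)) x := fun n i =>
    ((((hηB' n).mul hfb).add ((hηB n).mul hfb')).mul ((hx2 i).mul (pe _))).add
      (((hηB n).mul hfb).mul (pe _))
  have key : ∀ n, ∑ i, ∫ x in unitBall N, h x i * (η n (‖x‖ ^ 2) * profileGrad c S T H i x)
      = -∫ x in unitBall N, v x * (η n (‖x‖ ^ 2)
          * ((4 * ‖x‖ ^ 2 * f'' x + 2 * (N + 2 * l) * f' x) * polyEval H x)
        + deriv (η n) (‖x‖ ^ 2) * (2 * ‖x‖ ^ 2 * f' x + l * f x) * (2 * polyEval H x)) := by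
    intro n
    have e1 : ∀ i, ∫ x in unitBall N, h x i * (η n (‖x‖ ^ 2) * profileGrad c S T H i x)
        = -∫ x in unitBall N, (v x * (2 * ((deriv (η n) (‖x‖ ^ 2) * f' x + η n (‖x‖ ^ 2) * f'' x)
          * (2 * x i * polyEval (MvPolynomial.X i * H) x)
        + η n (‖x‖ ^ 2) * f' x
          * polyEval (MvPolynomial.pderiv i (MvPolynomial.X i * H)) x)
        + ((deriv (η n) (‖x‖ ^ 2) * f x + η n (‖x‖ ^ 2) * f' x)
          * (2 * x i * polyEval (MvPolynomial.pderiv i H) x)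
        + η n (‖x‖ ^ 2) * f x
          * polyEval (MvPolynomial.pderiv i (MvPolynomial.pderiv i H)) x))) := by
      intro i
      have i1 := hv.integrable.mul_isBoundedOnBall (hI1 n i)
      have i2 := hv.integrable.mul_isBoundedOnBall (hI2 n i)
      have j1 := (hv.integrable_apply i).mul_isBoundedOnBall (((hηB n).mul hfb').mul
        (pe (MvPolynomial.X i * H)))
      have j2 := (hv.integrable_apply i).mul_isBoundedOnBall (((hηB n).mul hfb).mul
        (pe (MvPolynomial.pderiv i H)))
      have e2 : ∫ x in unitBall N, h x i * (η n (‖x‖ ^ 2) * profileGrad c S T H i x)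
          = ∫ x in unitBall N, (2 * (h x i * (η n (‖x‖ ^ 2) * f' x
              * polyEval (MvPolynomial.X i * H) x))
            + h x i * (η n (‖x‖ ^ 2) * f x * polyEval (MvPolynomial.pderiv i H) x)) := by
        congr 1
        ext x
        simp only [profileGrad, f, f', polyEval_mul, polyEval_X]
        ring
      rw [e2, integral_add (j1.const_mul 2) j2, integral_const_mul, w1, w2, mul_neg, ← neg_add,
        ← integral_const_mul, ← integral_add (i1.const_mul 2) i2]
      congr 2
      ext x
      ring
    rw [Finset.sum_congr rfl fun i _ => e1 i, Finset.sum_neg_distrib, ← integral_finsetSum]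
    · congr 2
      ext x
      rw [← Finset.mul_sum, sum_divergence hH hH0]
    · intro i _
      exact hv.integrable.mul_isBoundedOnBall
        (((isBoundedOnBall_const 2).mul (hI1 n i)).add (hI2 n i))
  have l1 : Filter.Tendsto (fun n => ∑ i, ∫ x in unitBall N,
      h x i * (η n (‖x‖ ^ 2) * profileGrad c S T H i x)) Filter.atTop
      (nhds (∑ i, ∫ x in unitBall N, h x i * profileGrad c S T H i x)) := by
    refine tendsto_finsetSum _ fun i _ => ?_
    obtain ⟨C, hC0, hC⟩ := (hG i).bound
    refine tendsto_integral_mul_of_bounded (hv.integrable_apply i)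
      (fun n => ((hηB n).mul (hG i)).measurable) C (fun n x hx => ?_) (fun x hx => ?_)
    · rw [abs_mul]
      calc _ ≤ 1 * C := mul_le_mul (hηb _ _) (hC x hx) (abs_nonneg _) zero_le_one
        _ = C := one_mul C
    · simpa using (hlim _ (norm_sq_lt_one hx)).mul_const (profileGrad c S T H i x)
  have hΔ : IsBoundedOnBall fun x : EuclideanSpace ℝ (Fin N) =>
      (4 * ‖x‖ ^ 2 * f'' x + 2 * (N + 2 * l) * f' x) * polyEval H x :=
    (((Continuous.isBoundedOnBall (F := fun x => 4 * ‖x‖ ^ 2) (by fun_prop)).mul hfb'').add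
      ((isBoundedOnBall_const _).mul hfb')).mul (pe H)
  have hfl : IsBoundedOnBall fun x : EuclideanSpace ℝ (Fin N) =>
      (2 * ‖x‖ ^ 2 * f' x + l * f x) :=
    ((Continuous.isBoundedOnBall (F := fun x => 2 * ‖x‖ ^ 2) (by fun_prop)).mul hfb').add
      ((isBoundedOnBall_const _).mul hfb)
  have hH2 : IsBoundedOnBall fun x : EuclideanSpace ℝ (Fin N) => 2 * polyEval H x :=
    (isBoundedOnBall_const 2).mul (pe H)
  have l2 : Filter.Tendsto (fun n => ∫ x in unitBall N, v x * (η n (‖x‖ ^ 2)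
          * ((4 * ‖x‖ ^ 2 * f'' x + 2 * (N + 2 * l) * f' x) * polyEval H x)
        + deriv (η n) (‖x‖ ^ 2) * (2 * ‖x‖ ^ 2 * f' x + l * f x) * (2 * polyEval H x)))
      Filter.atTop (nhds (∫ x in unitBall N, v x *
        ((4 * ‖x‖ ^ 2 * f'' x + 2 * (N + 2 * l) * f' x) * polyEval H x))) := by
    obtain ⟨A, hA0, hA⟩ := hΔ.bound
    obtain ⟨B, hB0, hB⟩ := hH2.bound
    -- The Neumann condition removes the boundary term: `η'` grows like `n`, but it multiplies a
    -- flux of size `O(|s - 1|)`, so dominated convergence applies and the pointwise limit is `0`.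
    obtain ⟨L, hL0, hL⟩ := hf.exists_flux_bound
    obtain ⟨K, hK0, hK⟩ := exists_abs_sub_mul_deriv_smoothStep_le 1 2
    refine tendsto_integral_mul_of_bounded hv.integrable
      (fun n => (((hηB n).mul hΔ).add (((hηB' n).mul hfl).mul hH2)).measurable)
      (1 * A + (K * L) * B) (fun n x hx => ?_) (fun x hx => ?_)
    · refine (abs_add_le _ _).trans (add_le_add ?_ ?_)
      · rw [abs_mul]
        exact mul_le_mul (hηb _ _) (hA x hx) (abs_nonneg _) zero_le_one
      · rw [abs_mul]
        refine mul_le_mul ?_ (hB x hx) (abs_nonneg _) (by positivity)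
        rw [abs_mul, hη', abs_neg]
        calc |deriv (κ n) (‖x‖ ^ 2)| * |2 * ‖x‖ ^ 2 * f' x + l * f x|
            ≤ |deriv (κ n) (‖x‖ ^ 2)| * (L * |‖x‖ ^ 2 - 1|) :=
              mul_le_mul_of_nonneg_left (hL _ (norm_sq_mem_Icc hx)) (abs_nonneg _)
          _ = |‖x‖ ^ 2 - 1| * |deriv (κ n) (‖x‖ ^ 2)| * L := by ring
          _ ≤ K * L := mul_le_mul_of_nonneg_right (hK n _) hL0
    · have h1 := (hlim _ (norm_sq_lt_one hx)).mul_const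
        ((4 * ‖x‖ ^ 2 * f'' x + 2 * (N + 2 * l) * f' x) * polyEval H x)
      have h2 := ((hlim' _ (norm_sq_lt_one hx)).mul_const
        (2 * ‖x‖ ^ 2 * f' x + l * f x)).mul_const (2 * polyEval H x)
      simpa using h1.add h2
  rw [tendsto_nhds_unique l1 (l2.neg.congr fun n => (key n).symm)]
  congr 2
  ext x
  simp only [f', f'', radialLaplacian]
  split_ifs <;> rfl

end RadialField

/-! ### Profile functions as elements of `H¹`. -/

section ProfileFunction

/-- The function `f(|x|²) H(x)`, where `f` is `S` on `(-∞, c]` and `T` on `(c, ∞)`. -/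
def profileFun {N : ℕ} (c : ℝ) (S T : ℝ → ℝ) (H : MvPolynomial (Fin N) ℝ)
    (x : EuclideanSpace ℝ (Fin N)) : ℝ :=
  (if ‖x‖ ^ 2 ≤ c then S (‖x‖ ^ 2) else T (‖x‖ ^ 2)) * polyEval H x

variable {N l : ℕ} {c : ℝ} {S T : ℝ → ℝ} {H : MvPolynomial (Fin N) ℝ}

theorem IsNeumannProfile.hasDerivAt_ite (hf : IsNeumannProfile l c S T) (s : ℝ) :
    HasDerivAt (fun s => if s ≤ c then S s else T s) (if s ≤ c then deriv S s else deriv T s) s := by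
  have hS : HasDerivAt S (deriv S s) s := (hf.contDiff_left.differentiable (by simp) s).hasDerivAt
  have hT : HasDerivAt T (deriv T s) s := (hf.contDiff_right.differentiable (by simp) s).hasDerivAt
  rcases lt_trichotomy s c with h | h | h
  · rw [if_pos h.le]
    refine hS.congr_of_eventuallyEq ?_
    filter_upwards [gt_mem_nhds h] with t ht using if_pos ht.le
  · subst h
    rw [if_pos le_rfl, ← hasDerivWithinAt_univ, ← Set.Iic_union_Ici (a := s)]
    have hl : HasDerivWithinAt (fun t => if t ≤ s then S t else T t) (deriv S s) (Set.Iic s) s :=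
      hS.hasDerivWithinAt.congr (fun t ht => if_pos (Set.mem_Iic.1 ht)) (if_pos le_rfl)
    refine hl.union ?_
    rw [hf.deriv_eq]
    refine hT.hasDerivWithinAt.congr (fun t ht => ?_) ((if_pos le_rfl).trans hf.eq)
    rcases eq_or_lt_of_le (Set.mem_Ici.1 ht) with rfl | h
    · exact (if_pos le_rfl).trans hf.eq
    · exact if_neg (not_le.2 h)
  · rw [if_neg (not_le.2 h)]
    refine hT.congr_of_eventuallyEq ?_
    filter_upwards [lt_mem_nhds h] with t ht using if_neg (not_le.2 ht)

theorem IsNeumannProfile.continuous_ite (hf : IsNeumannProfile l c S T) :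
    Continuous fun s => if s ≤ c then S s else T s :=
  continuous_iff_continuousAt.2 fun s => (hf.hasDerivAt_ite s).continuousAt

theorem IsNeumannProfile.continuous_ite_deriv (hf : IsNeumannProfile l c S T) :
    Continuous fun s => if s ≤ c then deriv S s else deriv T s :=
  Continuous.if_le hf.contDiff_left.deriv_infty.continuous hf.contDiff_right.deriv_infty.continuous
    continuous_id continuous_const fun s hs => by
      obtain rfl : s = c := hs
      exact hf.deriv_eq

theorem IsNeumannProfile.continuous_profileFun (hf : IsNeumannProfile l c S T)
    (H : MvPolynomial (Fin N) ℝ) : Continuous (profileFun c S T H) :=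
  (hf.continuous_ite.comp (continuous_norm.pow 2)).mul (contDiff_polyEval H).continuous

theorem IsNeumannProfile.continuous_profileGrad (hf : IsNeumannProfile l c S T)
    (H : MvPolynomial (Fin N) ℝ) (i : Fin N) : Continuous (profileGrad c S T H i) := by
  have h1 := (contDiff_polyEval H).continuous
  exact ((hf.continuous_ite_deriv.comp (continuous_norm.pow 2)).mul
    (by fun_prop : Continuous fun x : EuclideanSpace ℝ (Fin N) => 2 * x i * polyEval H x)).add
    ((hf.continuous_ite.comp (continuous_norm.pow 2)).mul (contDiff_polyEval _).continuous)

/-- The gradient of `profileFun`. -/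
def profileGradVec {N : ℕ} (c : ℝ) (S T : ℝ → ℝ) (H : MvPolynomial (Fin N) ℝ)
    (x : EuclideanSpace ℝ (Fin N)) : EuclideanSpace ℝ (Fin N) :=
  WithLp.toLp 2 fun i => profileGrad c S T H i x

/-- The function is differentiable everywhere because the pieces match to first order at `c`. As the
test function vanishes off the ball, the integrals extend to the whole space and classical
integration by parts applies. -/
theorem IsNeumannProfile.hasH1Gradient (hf : IsNeumannProfile l c S T)
    (H : MvPolynomial (Fin N) ℝ) :
    HasH1Gradient (unitBall N) (profileFun c S T H) (profileGradVec c S T H) := by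
  have hw := hf.continuous_profileFun H
  refine ⟨hw.isBoundedOnBall.memLp, ?_, fun φ hφ i => ?_⟩
  · exact memLp_piLp_iff.2 fun i => (hf.continuous_profileGrad H i).isBoundedOnBall.memLp
  · have hg := hf.continuous_profileGrad H i
    have hd : ∀ x, DifferentiableAt ℝ (profileFun c S T H) x := fun x =>
      (hasFDerivAt_radial_mul (hf.hasDerivAt_ite (‖x‖ ^ 2)) H).differentiableAt
    have hd' : ∀ x, fderiv ℝ (profileFun c S T H) x (EuclideanSpace.single i 1)
        = profileGrad c S T H i x := fun x =>
      fderiv_radial_mul_apply (hf.hasDerivAt_ite (‖x‖ ^ 2)) H i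
    have hφ' : Continuous fun x => fderiv ℝ φ x (EuclideanSpace.single i 1) :=
      (hφ.smooth.continuous_fderiv (by simp)).clm_apply continuous_const
    have hφs : HasCompactSupport fun x => fderiv ℝ φ x (EuclideanSpace.single i 1) :=
      hφ.hasCompactSupport.fderiv_apply (𝕜 := ℝ) _
    have hout : ∀ x, x ∉ unitBall N → φ x = 0 := fun x hx =>
      image_eq_zero_of_notMem_tsupport fun h => hx (hφ.support_subset h)
    have hout' : ∀ x, x ∉ unitBall N → fderiv ℝ φ x (EuclideanSpace.single i 1) = 0 := fun x hx => by
      have : x ∉ tsupport (fderiv ℝ φ) := fun h =>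
        hx (hφ.support_subset (tsupport_fderiv_subset ℝ h))
      rw [image_eq_zero_of_notMem_tsupport this]
      rfl
    rw [setIntegral_eq_integral_of_forall_compl_eq_zero fun x hx => by rw [hout' x hx, mul_zero],
      setIntegral_eq_integral_of_forall_compl_eq_zero fun x hx => by rw [hout x hx, mul_zero]]
    rw [integral_mul_fderiv_eq_neg_fderiv_mul_of_integrable]
    · simp only [hd']
      rfl
    · simp only [hd']
      exact (hg.mul hφ.smooth.continuous).integrable_of_hasCompactSupport
        hφ.hasCompactSupport.mul_left
    · exact (hw.mul hφ').integrable_of_hasCompactSupport hφs.mul_left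
    · exact (hw.mul hφ.smooth.continuous).integrable_of_hasCompactSupport
        hφ.hasCompactSupport.mul_left
    · exact fun x _ => hd x
    · exact fun x _ => hφ.smooth.differentiable (by simp) x

theorem IsNeumannProfile.integral_inner (hf : IsNeumannProfile l c S T) (hH : H.IsHomogeneous l)
    (hH0 : polyLaplacian N H = 0) {v : EuclideanSpace ℝ (Fin N) → ℝ}
    {h : EuclideanSpace ℝ (Fin N) → EuclideanSpace ℝ (Fin N)}
    (hv : HasH1Gradient (unitBall N) v h) :
    ∫ x in unitBall N, inner ℝ (h x) (profileGradVec c S T H x)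
      = -∫ x in unitBall N, v x * ((if ‖x‖ ^ 2 ≤ c then radialLaplacian N l S (‖x‖ ^ 2)
          else radialLaplacian N l T (‖x‖ ^ 2)) * polyEval H x) := by
  rw [← hf.green hH hH0 hv, ← integral_finsetSum]
  · congr 1
    ext x
    rw [PiLp.inner_apply]
    refine Finset.sum_congr rfl fun i _ => ?_
    simp [profileGradVec, mul_comm]
  · intro i _
    exact (hv.integrable_apply i).mul_isBoundedOnBall
      (hf.continuous_profileGrad H i).isBoundedOnBall

end ProfileFunction

/-! ### The radial transmission problem. -/

section Profiles

/-- Smooth extension to the real line of a function that is smooth on `(0, ∞)`. -/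
theorem exists_contDiff_eqOn {f : ℝ → ℝ} (hf : ∀ s, 0 < s → ContDiffAt ℝ ∞ f s) {c : ℝ}
    (hc : 0 < c) : ∃ g : ℝ → ℝ, ContDiff ℝ ∞ g ∧ Set.EqOn g f (Set.Ioi (c / 2)) := by
  -- The argument of the transition is `0` at `c/4` and `1` at `c/2`.
  refine ⟨fun s => Real.smoothTransition (4 / c * (s - c / 4)) * f s, ?_, fun s hs => ?_⟩
  · rw [contDiff_iff_contDiffAt]
    intro s
    rcases lt_or_ge 0 s with h | h
    · refine ContDiffAt.mul ?_ (hf s h)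
      exact (Real.smoothTransition.contDiff.comp (by fun_prop :
        ContDiff ℝ ∞ fun s : ℝ => 4 / c * (s - c / 4))).contDiffAt
    · refine (contDiffAt_const (c := 0)).congr_of_eventuallyEq ?_
      filter_upwards [gt_mem_nhds (by linarith : s < c / 4)] with t ht
      rw [Real.smoothTransition.zero_of_nonpos, zero_mul]
      exact mul_nonpos_of_nonneg_of_nonpos (by positivity) (by linarith)
  · have hs : c / 2 < s := hs
    simp only
    rw [Real.smoothTransition.one_of_one_le, one_mul]
    calc (1 : ℝ) = 4 / c * (c / 2 - c / 4) := by field_simp; norm_num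
      _ ≤ _ := by gcongr

/-- The radial solutions of `s f'' + μ f' + γ f = 0`: the regular one `S` with the inner
coefficient, and two independent ones `g₁`, `g₂` with the outer coefficient. -/
structure IsRadialSystem (μ ci co c : ℝ) (S g₁ g₂ : ℝ → ℝ) : Prop where
  pos : 0 < c
  lt_one : c < 1
  contDiff_inner : ContDiff ℝ ∞ S
  contDiff_outer₁ : ContDiff ℝ ∞ g₁
  contDiff_outer₂ : ContDiff ℝ ∞ g₂
  ode_inner : ∀ s, s * deriv (deriv S) s + μ * deriv S s + ci * S s = 0
  ode_outer₁ : ∀ s, c < s → s * deriv (deriv g₁) s + μ * deriv g₁ s + co * g₁ s = 0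
  -- Required only beyond `c`: in the application the second outer solution may be singular at `0`
  -- and is replaced by a smooth function agreeing with it on `(c/2, ∞)`.
  ode_outer₂ : ∀ s, c < s → s * deriv (deriv g₂) s + μ * deriv g₂ s + co * g₂ s = 0
  wronskian_ne_zero : g₁ c * deriv g₂ c - deriv g₁ c * g₂ c ≠ 0
  zero_ne_zero : S 0 ≠ 0

/-- The flux at `1` of the outer continuation of the inner solution, up to the Wronskian. -/
def radialFlux (l : ℕ) (c : ℝ) (S g₁ g₂ : ℝ → ℝ) : ℝ :=
  (S c * deriv g₂ c - deriv S c * g₂ c) * (l * g₁ 1 + 2 * deriv g₁ 1)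
    + (deriv S c * g₁ c - S c * deriv g₁ c) * (l * g₂ 1 + 2 * deriv g₂ 1)

theorem deriv_comp_const_mul_apply (y : ℝ → ℝ) (γ s : ℝ) :
    deriv (fun s => y (γ * s)) s = γ * deriv y (γ * s) := by
  simpa using deriv_comp_mul_left γ y s

theorem deriv_deriv_comp_const_mul (y : ℝ → ℝ) (γ s : ℝ) :
    deriv (deriv fun s => y (γ * s)) s = γ ^ 2 * deriv (deriv y) (γ * s) := by
  have : (deriv fun s => y (γ * s)) = fun s => γ * deriv y (γ * s) :=
    funext fun s => deriv_comp_const_mul_apply y γ s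
  rw [this, deriv_const_mul_field, deriv_comp_const_mul_apply, sq, mul_assoc]

theorem besselOrder_add_one (N l : ℕ) : besselOrder N l + 1 = l + (N : ℝ) / 2 := by
  rw [besselOrder]
  ring

/-- If `y` solves Clifford's equation, then `y(γ s)` solves the radial equation with coefficient
`γ`, because `ν + 1 = l + N/2`. The inner solution is `C_ν(ci s)`; the outer ones are `C_ν(co s)`
and the rescaled second solution. -/
theorem exists_isRadialSystem {N : ℕ} (hN : 2 ≤ N) (l : ℕ) {M ε lam : ℝ} (hε0 : 0 < ε)
    (hε1 : ε < 1) (hρ : 0 < rhoTilde N M ε) (hlam : 0 < lam) :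
    ∃ S g₁ g₂ : ℝ → ℝ, IsRadialSystem (l + (N : ℝ) / 2) (lam * ε / 4) (lam * rhoTilde N M ε / 4)
        ((1 - ε) ^ 2) S g₁ g₂ ∧
      ((1 - (N : ℝ) / 2) * crossP1 (besselOrder N l) ε (aParam ε lam) (bParam N M ε lam)
        + bParam N M ε lam / (1 - ε) *
          crossP2 (besselOrder N l) ε (aParam ε lam) (bParam N M ε lam) = 0 ↔
        radialFlux l ((1 - ε) ^ 2) S g₁ g₂ = 0) := by
  obtain ⟨y, hy⟩ := exists_isSecondSolution hN l
  have hν0 := besselOrder_nonneg hN l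
  have hν : ∀ k : ℕ, (k : ℝ) + besselOrder N l + 1 ≠ 0 := fun k => by positivity
  have hcross := cross_eq_zero_iff hN l hy hε0 hε1 hρ hlam rfl rfl
  set ci := lam * ε / 4
  have hco : 0 < lam * rhoTilde N M ε / 4 := by positivity
  set co := lam * rhoTilde N M ε / 4
  have hc : 0 < (1 - ε) ^ 2 := pow_pos (by linarith) 2
  have hc1 : (1 - ε) ^ 2 < 1 := by nlinarith
  set c := (1 - ε) ^ 2
  set C := besselClifford (besselOrder N l)
  have hCs : ContDiff ℝ ∞ C := contDiff_powerSum (IsEntireSeries.besselCoeff hν)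
  have hscale : ∀ γ, ContDiff ℝ ∞ fun s => C (γ * s) := fun γ => hCs.comp (by fun_prop)
  have hode : ∀ γ s, s * deriv (deriv fun s => C (γ * s)) s
      + (l + (N : ℝ) / 2) * deriv (fun s => C (γ * s)) s + γ * C (γ * s) = 0 := by
    intro γ s
    rw [deriv_deriv_comp_const_mul, deriv_comp_const_mul_apply, ← besselOrder_add_one]
    linear_combination γ * besselClifford_ode hν (γ * s)
  obtain ⟨g, hg, hgy⟩ := exists_contDiff_eqOn (f := fun s => y (co * s)) (fun s hs =>
    (hy.isCliffordSolution.contDiffAt _ (mul_pos hco hs)).comp s (by fun_prop)) hc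
  have hev : ∀ s, c ≤ s → g =ᶠ[nhds s] fun s => y (co * s) := fun s hs =>
    hgy.eventuallyEq_of_mem (isOpen_Ioi.mem_nhds (by simp only [Set.mem_Ioi]; linarith))
  have hg0 : ∀ s, c ≤ s → g s = y (co * s) := fun s hs => (hev s hs).eq_of_nhds
  have hg1 : ∀ s, c ≤ s → deriv g s = co * deriv y (co * s) := fun s hs => by
    rw [(hev s hs).deriv_eq, deriv_comp_const_mul_apply]
  have hg2 : ∀ s, c ≤ s → deriv (deriv g) s = co ^ 2 * deriv (deriv y) (co * s) := fun s hs => by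
    rw [(hev s hs).deriv.deriv_eq, deriv_deriv_comp_const_mul]
  have hC0 : C 0 ≠ 0 := by
    simp only [C, besselClifford_zero]
    exact inv_ne_zero (Real.Gamma_pos_of_pos (by positivity)).ne'
  refine ⟨fun s => C (ci * s), fun s => C (co * s), g, ⟨hc, hc1, hscale ci, hscale co, hg, hode ci,
    fun s _ => hode co s, fun s hs => ?_, ?_, by simpa using hC0⟩, ?_⟩
  · have hs0 : 0 < s := hc.trans hs
    rw [hg2 s hs.le, hg1 s hs.le, hg0 s hs.le, ← besselOrder_add_one]
    linear_combination co * hy.isCliffordSolution.ode (co * s) (mul_pos hco hs0)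
  · rw [hg1 c le_rfl, hg0 c le_rfl, deriv_comp_const_mul_apply]
    have h1 := mul_ne_zero hco.ne' (hy.wronskian_ne_zero (co * c) (mul_pos hco hc))
    intro h
    apply h1
    linear_combination h
  · rw [hcross, radialFlux, hg1 c le_rfl, hg0 c le_rfl, hg1 1 hc1.le, hg0 1 hc1.le,
      deriv_comp_const_mul_apply, deriv_comp_const_mul_apply, deriv_comp_const_mul_apply, mul_one]
    refine Eq.congr_left ?_
    ring

variable {μ ci co c : ℝ} {S g₁ g₂ : ℝ → ℝ} {l : ℕ}

theorem deriv_linearCombination {f g : ℝ → ℝ} (hf : ContDiff ℝ ∞ f) (hg : ContDiff ℝ ∞ g)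
    (α β s : ℝ) : deriv (fun s => α * f s + β * g s) s = α * deriv f s + β * deriv g s :=
  (((hf.differentiable (by simp) s).hasDerivAt.const_mul α).add
    ((hg.differentiable (by simp) s).hasDerivAt.const_mul β)).deriv

theorem deriv_deriv_linearCombination {f g : ℝ → ℝ} (hf : ContDiff ℝ ∞ f) (hg : ContDiff ℝ ∞ g)
    (α β s : ℝ) : deriv (deriv fun s => α * f s + β * g s) s
      = α * deriv (deriv f) s + β * deriv (deriv g) s := by
  rw [funext (deriv_linearCombination hf hg α β),
    deriv_linearCombination hf.deriv_infty hg.deriv_infty]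

theorem contDiff_linearCombination {f g : ℝ → ℝ} (hf : ContDiff ℝ ∞ f) (hg : ContDiff ℝ ∞ g)
    (α β : ℝ) : ContDiff ℝ ∞ fun s => α * f s + β * g s :=
  (contDiff_const.mul hf).add (contDiff_const.mul hg)

/-- If the flux vanishes, the homogeneous transmission problem has a regular solution. -/
theorem IsRadialSystem.exists_homogeneous (h : IsRadialSystem μ ci co c S g₁ g₂)
    (hflux : radialFlux l c S g₁ g₂ = 0) :
    ∃ U V : ℝ → ℝ, IsNeumannProfile l c U V ∧ U 0 ≠ 0 ∧
      (∀ s, s * deriv (deriv U) s + μ * deriv U s + ci * U s = 0) ∧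
      ∀ s, c < s → s * deriv (deriv V) s + μ * deriv V s + co * V s = 0 := by
  have hg₁ := h.contDiff_outer₁
  have hg₂ := h.contDiff_outer₂
  have hS := h.contDiff_inner
  set W := g₁ c * deriv g₂ c - deriv g₁ c * g₂ c with hW
  have hU' : ∀ s, deriv (fun s => W * S s) s = W * deriv S s := fun s => deriv_const_mul_field W
  have hU'' : ∀ s, deriv (deriv fun s => W * S s) s = W * deriv (deriv S) s := fun s => by
    rw [funext hU', deriv_const_mul_field]
  -- Cramer's rule for matching value and derivative at `c`, multiplied through by the Wronskian
  -- `W`. The flux of the outer piece at `1` is then exactly `radialFlux`.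
  refine ⟨fun s => W * S s, fun s => (S c * deriv g₂ c - deriv S c * g₂ c) * g₁ s
      + (deriv S c * g₁ c - S c * deriv g₁ c) * g₂ s,
    ⟨h.pos, h.lt_one, contDiff_const.mul hS, contDiff_linearCombination hg₁ hg₂ _ _, ?_, ?_, ?_⟩,
    mul_ne_zero h.wronskian_ne_zero h.zero_ne_zero, fun s => ?_, fun s hs => ?_⟩
  · simp only [hW]
    ring
  · rw [hU', deriv_linearCombination hg₁ hg₂, hW]
    ring
  · rw [deriv_linearCombination hg₁ hg₂]
    rw [radialFlux] at hflux
    linear_combination hflux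
  · rw [hU'', hU']
    linear_combination W * h.ode_inner s
  · rw [deriv_linearCombination hg₁ hg₂, deriv_deriv_linearCombination hg₁ hg₂]
    linear_combination (S c * deriv g₂ c - deriv S c * g₂ c) * h.ode_outer₁ s hs
      + (deriv S c * g₁ c - S c * deriv g₁ c) * h.ode_outer₂ s hs

/-- The equation `s p'' + μ p' + γ p = s^j` has a polynomial solution. -/
theorem exists_polynomial_solution (μ : ℝ) {γ : ℝ} (hγ : γ ≠ 0) (j : ℕ) :
    ∃ p : Polynomial ℝ, Polynomial.X * p.derivative.derivative
      + Polynomial.C μ * p.derivative + Polynomial.C γ * p = Polynomial.X ^ j := by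
  have hC : Polynomial.C γ * Polynomial.C γ⁻¹ = 1 := by
    rw [← Polynomial.C_mul, mul_inv_cancel₀ hγ, Polynomial.C_1]
  induction j with
  | zero =>
    refine ⟨Polynomial.C γ⁻¹, ?_⟩
    simpa using hC
  | succ j ih =>
    obtain ⟨p, hp⟩ := ih
    -- The operator maps `s^(j+1)` to `γ s^(j+1) + (j+1)(j+μ) s^j`, and `p` removes the second term.
    refine ⟨Polynomial.C γ⁻¹ *
      (Polynomial.X ^ (j + 1) - Polynomial.C ((j + 1) * (j + μ)) * p), ?_⟩
    rcases j with _ | j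
    · simp at hp ⊢
      linear_combination Polynomial.X * hC
        - Polynomial.C γ⁻¹ * Polynomial.C μ * hp
    · simp at hp ⊢
      linear_combination Polynomial.X ^ (j + 1 + 1) * hC
        - Polynomial.C γ⁻¹ * ((j : Polynomial ℝ) + 1 + 1)
          * ((j : Polynomial ℝ) + 1 + Polynomial.C μ) * hp

theorem exists_particular_solution (μ : ℝ) {γ : ℝ} (hγ : γ ≠ 0) (a : ℝ) (j : ℕ) :
    ∃ p : ℝ → ℝ, ContDiff ℝ ∞ p ∧
      ∀ s, s * deriv (deriv p) s + μ * deriv p s + γ * p s = a * s ^ j := by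
  obtain ⟨p, hp⟩ := exists_polynomial_solution μ hγ j
  have h1 : deriv (fun s => (Polynomial.C a * p).eval s)
      = fun s => (Polynomial.C a * p).derivative.eval s := funext fun s => Polynomial.deriv _
  have h2 : deriv (fun s => (Polynomial.C a * p).derivative.eval s)
      = fun s => (Polynomial.C a * p).derivative.derivative.eval s :=
    funext fun s => Polynomial.deriv _
  refine ⟨fun s => (Polynomial.C a * p).eval s, ?_, fun s => ?_⟩
  · exact (Polynomial.C a * p).contDiff_aeval (𝕜 := ℝ) ∞
  have := congrArg (Polynomial.eval s) hp
  simp only [h1, h2]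
  simp at this ⊢
  linear_combination a * this

/-- If the flux does not vanish, the inhomogeneous transmission problem is solvable. -/
theorem IsRadialSystem.exists_inhomogeneous (h : IsRadialSystem μ ci co c S g₁ g₂)
    (hflux : radialFlux l c S g₁ g₂ ≠ 0) (hci : ci ≠ 0) (hco : co ≠ 0) (a b : ℝ) (j : ℕ) :
    ∃ U V : ℝ → ℝ, IsNeumannProfile l c U V ∧
      (∀ s, s * deriv (deriv U) s + μ * deriv U s + ci * U s = a * s ^ j) ∧
      ∀ s, c < s → s * deriv (deriv V) s + μ * deriv V s + co * V s = b * s ^ j := by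
  obtain ⟨p, hp, hpo⟩ := exists_particular_solution μ hci a j
  obtain ⟨q, hq, hqo⟩ := exists_particular_solution μ hco b j
  have hg₁ := h.contDiff_outer₁
  have hg₂ := h.contDiff_outer₂
  have hS := h.contDiff_inner
  have hW := h.wronskian_ne_zero
  set W := g₁ c * deriv g₂ c - deriv g₁ c * g₂ c with hWdef
  -- Cramer's rule again: `α g₁ + β g₂` has the value and the derivative of `p - q` at `c`.
  obtain ⟨α, hα⟩ : ∃ α, α = ((p c - q c) * deriv g₂ c - (deriv p c - deriv q c) * g₂ c) / W :=
    ⟨_, rfl⟩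
  obtain ⟨β, hβ⟩ : ∃ β, β = ((deriv p c - deriv q c) * g₁ c - (p c - q c) * deriv g₁ c) / W :=
    ⟨_, rfl⟩
  -- Adding `t` times the matched homogeneous solution keeps the matching at `c` and shifts the flux
  -- at `1` by `t * radialFlux`; `t` is chosen to make the total flux zero.
  obtain ⟨t, ht⟩ : ∃ t, t * radialFlux l c S g₁ g₂ = -(2 * (deriv q 1 + (α * deriv g₁ 1
      + β * deriv g₂ 1)) + l * (q 1 + (α * g₁ 1 + β * g₂ 1))) :=
    ⟨_, div_mul_cancel₀ _ hflux⟩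
  obtain ⟨A, hA⟩ : ∃ A, A = α + t * (S c * deriv g₂ c - deriv S c * g₂ c) := ⟨_, rfl⟩
  obtain ⟨B, hB⟩ : ∃ B, B = β + t * (deriv S c * g₁ c - S c * deriv g₁ c) := ⟨_, rfl⟩
  have hV := contDiff_linearCombination hg₁ hg₂ A B
  have hV' := deriv_linearCombination hg₁ hg₂ A B
  have hV'' := deriv_deriv_linearCombination hg₁ hg₂ A B
  refine ⟨fun s => 1 * p s + t * W * S s, fun s => 1 * q s + 1 * (A * g₁ s + B * g₂ s),
    ⟨h.pos, h.lt_one, contDiff_linearCombination hp hS _ _, contDiff_linearCombination hq hV _ _,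
      ?_, ?_, ?_⟩, fun s => ?_, fun s hs => ?_⟩
  · simp only [hA, hB, hα, hβ]
    field_simp
    rw [hWdef]
    ring
  · rw [deriv_linearCombination hp hS, deriv_linearCombination hq hV, hV']
    simp only [hA, hB, hα, hβ]
    field_simp
    rw [hWdef]
    ring
  · rw [deriv_linearCombination hq hV, hV', hA, hB]
    rw [radialFlux] at ht
    linear_combination ht
  · rw [deriv_linearCombination hp hS, deriv_deriv_linearCombination hp hS]
    linear_combination hpo s + t * W * h.ode_inner s
  · rw [deriv_linearCombination hq hV, deriv_deriv_linearCombination hq hV, hV', hV'']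
    linear_combination hqo s + A * h.ode_outer₁ s hs + B * h.ode_outer₂ s hs

end Profiles

/-! ### Density of polynomials on the ball. -/

section Density

variable {N : ℕ}

/-- The algebra of polynomial functions on the closed unit ball. -/
def polyFunctionsOnBall (N : ℕ) :
    Subalgebra ℝ C(Metric.closedBall (0 : EuclideanSpace ℝ (Fin N)) 1, ℝ) :=
  (MvPolynomial.aeval fun i : Fin N =>
    (⟨fun x => (x : EuclideanSpace ℝ (Fin N)) i, by fun_prop⟩ :
      C(Metric.closedBall (0 : EuclideanSpace ℝ (Fin N)) 1, ℝ))).range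

theorem aeval_coordinates_apply (p : MvPolynomial (Fin N) ℝ)
    (x : Metric.closedBall (0 : EuclideanSpace ℝ (Fin N)) 1) :
    (MvPolynomial.aeval fun i : Fin N =>
    (⟨fun x => (x : EuclideanSpace ℝ (Fin N)) i, by fun_prop⟩ :
      C(Metric.closedBall (0 : EuclideanSpace ℝ (Fin N)) 1, ℝ))) p x = polyEval p x := by
  induction p using MvPolynomial.induction_on with
  | C a => simp [polyEval]
  | add p q hp hq => simp [polyEval_add, hp, hq]
  | mul_X p i hp => simp [polyEval_mul, polyEval_X, hp]

theorem polyFunctionsOnBall_separatesPoints (N : ℕ) : (polyFunctionsOnBall N).SeparatesPoints := by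
  intro x y hxy
  obtain ⟨i, hi⟩ : ∃ i, (x : EuclideanSpace ℝ (Fin N)) i ≠ (y : EuclideanSpace ℝ (Fin N)) i := by
    by_contra! h
    exact hxy (Subtype.ext (PiLp.ext h))
  refine ⟨_, ⟨_, ⟨MvPolynomial.X i, rfl⟩, rfl⟩, ?_⟩
  intro h
  have h' := (aeval_coordinates_apply (MvPolynomial.X i) x).symm.trans
    (h.trans (aeval_coordinates_apply (MvPolynomial.X i) y))
  rw [polyEval_X, polyEval_X] at h'
  exact hi h'

/-- Stone–Weierstrass on the closed ball, where the coordinate functions separate points. -/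
theorem exists_polyEval_near {f : EuclideanSpace ℝ (Fin N) → ℝ} (hf : Continuous f) {δ : ℝ}
    (hδ : 0 < δ) : ∃ p : MvPolynomial (Fin N) ℝ, ∀ x ∈ unitBall N, |polyEval p x - f x| ≤ δ := by
  obtain ⟨⟨_, p, rfl⟩, hg⟩ :=
    ContinuousMap.exists_mem_subalgebra_near_continuousMap_of_separatesPoints
      (polyFunctionsOnBall N) (polyFunctionsOnBall_separatesPoints N)
      ⟨fun x => f x, hf.comp continuous_subtype_val⟩ δ hδ
  refine ⟨p, fun x hx => ?_⟩
  have := (ContinuousMap.norm_coe_le_norm _ ⟨x, Metric.ball_subset_closedBall hx⟩).trans hg.le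
  rw [ContinuousMap.sub_apply] at this
  change |_ - f x| ≤ δ at this
  rwa [← aeval_coordinates_apply p ⟨x, Metric.ball_subset_closedBall hx⟩]

/-- An integrable function on the ball that is orthogonal to all polynomials vanishes. -/
theorem ae_eq_zero_of_integral_mul_polyEval {w : EuclideanSpace ℝ (Fin N) → ℝ}
    (hw : Integrable w (volume.restrict (unitBall N)))
    (h : ∀ p : MvPolynomial (Fin N) ℝ, ∫ x in unitBall N, w x * polyEval p x = 0) :
    ∀ᵐ x ∂(volume.restrict (unitBall N)), w x = 0 := by
  rw [ae_restrict_iff' (measurableSet_unitBall N)]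
  refine IsOpen.ae_eq_zero_of_integral_contDiff_smul_eq_zero Metric.isOpen_ball
    (IntegrableOn.locallyIntegrableOn hw) fun g hg _ hgs => ?_
  have hout : ∀ x, x ∉ unitBall N → g x • w x = 0 := fun x hx => by
    rw [image_eq_zero_of_notMem_tsupport fun h => hx (hgs h), zero_smul]
  rw [← setIntegral_eq_integral_of_forall_compl_eq_zero hout]
  have hb := hg.continuous.isBoundedOnBall
  refine abs_eq_zero.1 (le_antisymm (le_of_forall_pos_le_add fun δ hδ => ?_) (abs_nonneg _))
  set K := ∫ x in unitBall N, |w x|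
  have hK : 0 ≤ K := integral_nonneg fun x => abs_nonneg _
  -- Dividing by `K + 1` avoids a separate case `K = 0`.
  obtain ⟨p, hp⟩ := exists_polyEval_near hg.continuous (div_pos hδ (by positivity : 0 < K + 1))
  have hpb := isBoundedOnBall_polyEval p
  have e : ∫ x in unitBall N, g x • w x = ∫ x in unitBall N, -(w x * (polyEval p x - g x)) := by
    have h1 : (fun x => -(w x * (polyEval p x - g x)))
        = fun x => w x * g x - w x * polyEval p x := by
      ext x
      ring
    rw [h1, integral_sub (hw.mul_isBoundedOnBall hb) (hw.mul_isBoundedOnBall hpb), h p, sub_zero]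
    simp only [smul_eq_mul, mul_comm]
  rw [e, zero_add]
  calc |∫ x in unitBall N, -(w x * (polyEval p x - g x))|
      ≤ ∫ x in unitBall N, |w x| * (δ / (K + 1)) := by
        refine norm_integral_le_of_norm_le (G := ℝ) (hw.abs.mul_const _) ?_
        rw [ae_restrict_iff' (measurableSet_unitBall N)]
        refine .of_forall fun x hx => ?_
        rw [norm_neg, norm_mul]
        exact mul_le_mul_of_nonneg_left (hp x hx) (abs_nonneg _)
    _ = K * (δ / (K + 1)) := integral_mul_const _ _
    _ ≤ δ := by
        rw [mul_div_assoc', div_le_iff₀ (by positivity)]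
        nlinarith

end Density

/-! ### Eigenvalues and the radial flux. -/

section Eigenvalue

variable {N : ℕ} {M ε lam : ℝ}

theorem rhoTilde_pos (hN : 2 ≤ N) (hε0 : 0 < ε) (hε1 : ε < 1)
    (hmass : ε * ballVolume N * (1 - ε) ^ N < M) : 0 < rhoTilde N M ε := by
  have h1 : (1 - ε) ^ N < 1 := pow_lt_one₀ (by linarith) (by linarith) (by omega)
  have h2 : 0 < ballVolume N := by
    have := Metric.isOpen_ball.measure_pos volume
      (Metric.nonempty_ball.2 one_pos : (Metric.ball (0 : EuclideanSpace ℝ (Fin N)) 1).Nonempty)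
    exact ENNReal.toReal_pos this.ne' measure_ball_lt_top.ne
  exact div_pos (by linarith) (mul_pos h2 (by linarith))

theorem norm_le_iff_norm_sq_le (hε1 : ε < 1) (x : EuclideanSpace ℝ (Fin N)) :
    ‖x‖ ≤ 1 - ε ↔ ‖x‖ ^ 2 ≤ (1 - ε) ^ 2 :=
  (pow_le_pow_iff_left₀ (norm_nonneg x) (by linarith) two_ne_zero).symm

theorem density_pos (hε0 : 0 < ε) (hρ : 0 < rhoTilde N M ε) (x : EuclideanSpace ℝ (Fin N)) :
    0 < density N M ε x := by
  rw [density]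
  split_ifs <;> assumption

theorem isBoundedOnBall_density (hε1 : ε < 1) : IsBoundedOnBall (density N M ε) := by
  have := isBoundedOnBall_ite (N := N) (continuous_const (y := ε))
    (continuous_const (y := rhoTilde N M ε)) ((1 - ε) ^ 2)
  simp only [← norm_le_iff_norm_sq_le hε1] at this
  exact this

/-- Four times the radial equation; this is the origin of the quarters in the coefficients. -/
theorem radialLaplacian_eq {l : ℕ} {S : ℝ → ℝ} {s γ r : ℝ}
    (h : s * deriv (deriv S) s + (l + (N : ℝ) / 2) * deriv S s + lam * γ / 4 * S s
      = -γ / 4 * r) : radialLaplacian N l S s = -(γ * (lam * S s + r)) := by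
  rw [radialLaplacian]
  linear_combination 4 * h

/-- The weak form of `-Δ(f(|x|²) H) = ρ (λ f(|x|²) + r |x|^{2j}) H` with Neumann boundary
condition. -/
theorem IsNeumannProfile.integral_inner_eq {l j : ℕ} {r : ℝ} {U V : ℝ → ℝ}
    {H : MvPolynomial (Fin N) ℝ} (hε1 : ε < 1) (hf : IsNeumannProfile l ((1 - ε) ^ 2) U V)
    (hH : H.IsHomogeneous l) (hH0 : polyLaplacian N H = 0)
    (hU : ∀ s, s * deriv (deriv U) s + (l + (N : ℝ) / 2) * deriv U s + lam * ε / 4 * U s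
      = -ε / 4 * (r * s ^ j))
    (hV : ∀ s, (1 - ε) ^ 2 < s → s * deriv (deriv V) s + (l + (N : ℝ) / 2) * deriv V s
      + lam * rhoTilde N M ε / 4 * V s = -rhoTilde N M ε / 4 * (r * s ^ j))
    {v : EuclideanSpace ℝ (Fin N) → ℝ} {h : EuclideanSpace ℝ (Fin N) → EuclideanSpace ℝ (Fin N)}
    (hv : HasH1Gradient (unitBall N) v h) :
    ∫ x in unitBall N, inner ℝ (h x) (profileGradVec ((1 - ε) ^ 2) U V H x)
      = lam * (∫ x in unitBall N, density N M ε x * v x * profileFun ((1 - ε) ^ 2) U V H x)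
        + r * ∫ x in unitBall N, density N M ε x * v x * polyEval (normSqPoly N ^ j * H) x := by
  have hd := isBoundedOnBall_density (N := N) (M := M) hε1
  have i1 := hv.integrable.mul_isBoundedOnBall
    (hd.mul (hf.continuous_profileFun H).isBoundedOnBall)
  have i2 := hv.integrable.mul_isBoundedOnBall
    (hd.mul (isBoundedOnBall_polyEval (normSqPoly N ^ j * H)))
  have e1 : (fun x => density N M ε x * v x * profileFun ((1 - ε) ^ 2) U V H x)
      = fun x => v x * (density N M ε x * profileFun ((1 - ε) ^ 2) U V H x) := by
    ext x; ring
  have e2 : (fun x => density N M ε x * v x * polyEval (normSqPoly N ^ j * H) x)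
      = fun x => v x * (density N M ε x * polyEval (normSqPoly N ^ j * H) x) := by
    ext x; ring
  rw [hf.integral_inner hH hH0 hv, e1, e2, ← integral_const_mul, ← integral_const_mul,
    ← integral_add (i1.const_mul lam) (i2.const_mul r), ← integral_neg]
  congr 1
  ext x
  have hp : polyEval (normSqPoly N ^ j * H) x = (‖x‖ ^ 2) ^ j * polyEval H x := by
    rw [polyEval_mul, ← polyEval_normSqPoly]
    simp [polyEval]
  rw [hp, density, profileFun]
  simp only [norm_le_iff_norm_sq_le hε1]
  split_ifs with hx
  · rw [radialLaplacian_eq (hU _)]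
    ring
  · rw [radialLaplacian_eq (hV _ (not_le.1 hx))]
    ring

/-- If all fluxes are nonzero there is no eigenfunction. -/
theorem ae_eq_zero_of_radialFlux_ne_zero (hN : 2 ≤ N) (hε0 : 0 < ε) (hε1 : ε < 1)
    (hρ : 0 < rhoTilde N M ε) (hlam : 0 < lam) {u : EuclideanSpace ℝ (Fin N) → ℝ}
    {g : EuclideanSpace ℝ (Fin N) → EuclideanSpace ℝ (Fin N)}
    (hu : HasH1Gradient (unitBall N) u g)
    (heig : ∀ (v : EuclideanSpace ℝ (Fin N) → ℝ)
      (h : EuclideanSpace ℝ (Fin N) → EuclideanSpace ℝ (Fin N)), HasH1Gradient (unitBall N) v h →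
        ∫ x in unitBall N, inner ℝ (g x) (h x)
          = lam * ∫ x in unitBall N, density N M ε x * u x * v x)
    (hflux : ∀ l : ℕ, ∃ S g₁ g₂ : ℝ → ℝ, IsRadialSystem (l + (N : ℝ) / 2) (lam * ε / 4)
      (lam * rhoTilde N M ε / 4) ((1 - ε) ^ 2) S g₁ g₂ ∧
      radialFlux l ((1 - ε) ^ 2) S g₁ g₂ ≠ 0) :
    ∀ᵐ x ∂(volume.restrict (unitBall N)), u x = 0 := by
  have hd := isBoundedOnBall_density (N := N) (M := M) hε1
  have hw : Integrable (fun x => density N M ε x * u x) (volume.restrict (unitBall N)) :=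
    (hu.integrable.mul_isBoundedOnBall hd).congr (.of_forall fun x => mul_comm _ _)
  have key : ∀ (l j : ℕ) (H : MvPolynomial (Fin N) ℝ), H.IsHomogeneous l → polyLaplacian N H = 0 →
      ∫ x in unitBall N, density N M ε x * u x * polyEval (normSqPoly N ^ j * H) x = 0 := by
    intro l j H hH hH0
    obtain ⟨S, g₁, g₂, hsys, hfl⟩ := hflux l
    -- The resulting `w` satisfies `-Δw = ρ (λ w + |x|^(2j) H)`. Both Green's formula and the
    -- eigenvalue equation evaluate `∫ ∇u · ∇w`, and their difference is the required integral.
    obtain ⟨U, V, hf, hU, hV⟩ := hsys.exists_inhomogeneous hfl (by positivity) (by positivity)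
      (-ε / 4) (-rhoTilde N M ε / 4) j
    have h1 := hf.integral_inner_eq (M := M) (lam := lam) (r := 1) (j := j) hε1 hH hH0
      (fun s => by rw [one_mul]; exact hU s) (fun s hs => by rw [one_mul]; exact hV s hs) hu
    rw [heig _ _ (hf.hasH1Gradient H)] at h1
    linarith
  have hall : ∀ p : MvPolynomial (Fin N) ℝ,
      ∫ x in unitBall N, density N M ε x * u x * polyEval p x = 0 := by
    let P : Submodule ℝ (MvPolynomial (Fin N) ℝ) :=
      { carrier := {p | ∫ x in unitBall N, density N M ε x * u x * polyEval p x = 0}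
        zero_mem' := by simp [polyEval]
        add_mem' := fun {p q} hp hq => by
          have hp : ∫ x in unitBall N, density N M ε x * u x * polyEval p x = 0 := hp
          have hq : ∫ x in unitBall N, density N M ε x * u x * polyEval q x = 0 := hq
          simp only [Set.mem_ofPred_eq, polyEval_add, mul_add]
          rw [integral_add (hw.mul_isBoundedOnBall (isBoundedOnBall_polyEval p))
            (hw.mul_isBoundedOnBall (isBoundedOnBall_polyEval q)), hp, hq, add_zero]
        smul_mem' := fun a p hp => by
          have hp : ∫ x in unitBall N, density N M ε x * u x * polyEval p x = 0 := hp
          have e : ∀ x, density N M ε x * u x * polyEval (a • p) x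
              = a * (density N M ε x * u x * polyEval p x) := fun x => by
            simp only [polyEval, MvPolynomial.smul_eval]
            ring
          simp only [Set.mem_ofPred_eq, e]
          rw [integral_const_mul, hp, mul_zero] }
    have hP : P = ⊤ := eq_top_of_normSqPoly_pow_mul_mem (by omega) P key
    intro p
    have : p ∈ P := hP ▸ Submodule.mem_top
    exact this
  filter_upwards [ae_eq_zero_of_integral_mul_polyEval hw hall] with x hx
  exact (mul_eq_zero.1 hx).resolve_left (density_pos hε0 hρ x).ne'

/-- Testing with `u` gives `∫ |∇u|² = λ ∫ ρ u²`; for negative `λ` both sides must vanish, which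
forces `u = 0` since `ρ > 0`. -/
theorem lam_pos_of_eigenvalue (hε0 : 0 < ε) (hε1 : ε < 1) (hρ : 0 < rhoTilde N M ε)
    (h0 : lam ≠ 0) (h : IsNeumannEigenvalue N M ε lam) : 0 < lam := by
  obtain ⟨u, hne, g, hu, heig⟩ := h
  by_contra hlam
  have hlam : lam < 0 := lt_of_le_of_ne (not_lt.1 hlam) h0
  have h1 := heig u g hu
  have h2 : 0 ≤ ∫ x in unitBall N, inner ℝ (g x) (g x) :=
    integral_nonneg fun x => real_inner_self_nonneg
  have hnn : ∀ x, 0 ≤ density N M ε x * u x * u x := fun x => by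
    rw [mul_assoc]
    exact mul_nonneg (density_pos hε0 hρ x).le (mul_self_nonneg _)
  have h3 : 0 ≤ ∫ x in unitBall N, density N M ε x * u x * u x := integral_nonneg hnn
  have h4 : ∫ x in unitBall N, density N M ε x * u x * u x = 0 := by nlinarith
  have hint : Integrable (fun x => density N M ε x * u x * u x)
      (volume.restrict (unitBall N)) :=
    ((hu.memLp.integrable_sq).mul_isBoundedOnBall
      (isBoundedOnBall_density (M := M) hε1)).congr (.of_forall fun x => by ring)
  rw [integral_eq_zero_iff_of_nonneg hnn hint] at h4
  apply hne
  filter_upwards [h4] with x hx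
  have hx : density N M ε x * u x * u x = 0 := hx
  have := (density_pos hε0 hρ x).ne'
  simpa [this] using hx

/-- On the axis of `x_i` the pair represents the power of a real number, so its first component does
not vanish there off the origin. The nontriviality of the eigenfunction rests on this. -/
theorem polyEval_planarHarmonic (i j : Fin N) (hij : i ≠ j) (l : ℕ) (t : ℝ) :
    polyEval (planarHarmonic i j l).1 (EuclideanSpace.single i t) = t ^ l ∧
    polyEval (planarHarmonic i j l).2 (EuclideanSpace.single i t) = 0 := by
  induction l with
  | zero => simp [planarHarmonic, polyEval]
  | succ l ih =>
    have h1 : ∀ p q : MvPolynomial (Fin N) ℝ, ∀ x, polyEval (p - q) x = polyEval p x - polyEval q x :=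
      fun p q x => by simp [polyEval]
    simp [planarHarmonic, h1, polyEval_add, polyEval_mul, polyEval_X, ih.1, ih.2, hij.symm, pow_succ']

/-- If some flux vanishes there is an eigenfunction. -/
theorem isNeumannEigenvalue_of_radialFlux_eq_zero (hN : 2 ≤ N) (hε1 : ε < 1)
    {l : ℕ} {S g₁ g₂ : ℝ → ℝ} (hsys : IsRadialSystem (l + (N : ℝ) / 2) (lam * ε / 4)
      (lam * rhoTilde N M ε / 4) ((1 - ε) ^ 2) S g₁ g₂)
    (hflux : radialFlux l ((1 - ε) ^ 2) S g₁ g₂ = 0) : IsNeumannEigenvalue N M ε lam := by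
  obtain ⟨U, V, hf, hU0, hU, hV⟩ := hsys.exists_homogeneous hflux
  set i : Fin N := ⟨0, by omega⟩
  set j : Fin N := ⟨1, by omega⟩
  have hij : i ≠ j := by simp [i, j]
  set H := (planarHarmonic i j l).1
  have hH : H.IsHomogeneous l := (isHomogeneous_planarHarmonic i j l).1
  have hH0 : polyLaplacian N H = 0 := polyLaplacian_planarHarmonic hij l
  have hwc := hf.continuous_profileFun H
  refine ⟨profileFun ((1 - ε) ^ 2) U V H, fun hae => ?_, profileGradVec ((1 - ε) ^ 2) U V H,
    hf.hasH1Gradient H, fun v h hv => ?_⟩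
  · have hz : Set.EqOn (profileFun ((1 - ε) ^ 2) U V H) (fun _ => 0) (unitBall N) :=
      Measure.eqOn_open_of_ae_eq hae Metric.isOpen_ball hwc.continuousOn continuousOn_const
    -- Since `U 0 ≠ 0`, the function is nonzero at a point of the axis close to the origin, inside
    -- the inner ball where the profile is `U`.
    have hUt : ∀ᶠ t in nhds (0 : ℝ), U (t ^ 2) ≠ 0 := by
      have : Filter.Tendsto (fun t : ℝ => U (t ^ 2)) (nhds 0) (nhds (U 0)) := by
        have := (hf.contDiff_left.continuous.comp (continuous_pow 2)).tendsto (0 : ℝ)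
        simpa [Function.comp_def] using this
      exact this.eventually_ne hU0
    have hsmall : ∀ᶠ t in nhds (0 : ℝ), t ^ 2 < (1 - ε) ^ 2 ∧ |t| < 1 := by
      refine Filter.Eventually.and ?_ ?_
      · have : Filter.Tendsto (fun t : ℝ => t ^ 2) (nhds 0) (nhds 0) := by
          have := (continuous_pow 2).tendsto (0 : ℝ)
          simpa using this
        exact this.eventually_lt_const hsys.pos
      · have : Filter.Tendsto (fun t : ℝ => |t|) (nhds 0) (nhds 0) := by
          simpa using continuous_abs.tendsto (0 : ℝ)
        exact this.eventually_lt_const one_pos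
    obtain ⟨t, ⟨ht, ht2, ht1⟩, ht0⟩ := (((hUt.and hsmall).filter_mono
      (nhdsWithin_le_nhds (s := Set.Ioi 0))).and self_mem_nhdsWithin).exists
    have ht0 : 0 < t := ht0
    have hx : EuclideanSpace.single i t ∈ unitBall N := by simpa [unitBall] using ht1
    have := hz hx
    simp only [profileFun, PiLp.norm_single, Real.norm_eq_abs, sq_abs, if_pos ht2.le, H,
      (polyEval_planarHarmonic i j hij l t).1] at this
    exact mul_ne_zero ht (pow_ne_zero l ht0.ne') this
  · have h1 := hf.integral_inner_eq (M := M) (lam := lam) (r := 0) (j := 0) hε1 hH hH0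
      (fun s => by rw [hU s]; ring) (fun s hs => by rw [hV s hs]; ring) hv
    rw [zero_mul, add_zero] at h1
    simp only [real_inner_comm] at h1 ⊢
    rw [h1]
    congr 2
    ext x
    ring

end Eigenvalue
end

theorem proposition2p2 (N : ℕ) (hN : 2 ≤ N) (M : ℝ) (hM : 0 < M) (ε : ℝ) (hε0 : 0 < ε)
    (hε1 : ε < 1) (hmass : ε * ballVolume N * (1 - ε) ^ N < M) (lam : ℝ) :
    (lam ≠ 0 ∧ IsNeumannEigenvalue N M ε lam) ↔
      0 < lam ∧ ∃ l : ℕ,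
        (1 - (N : ℝ) / 2) *
            crossP1 (besselOrder N l) ε (aParam ε lam) (bParam N M ε lam)
          + bParam N M ε lam / (1 - ε) *
            crossP2 (besselOrder N l) ε (aParam ε lam) (bParam N M ε lam) = 0 := by
  have hρ := rhoTilde_pos hN hε0 hε1 hmass
  constructor
  · rintro ⟨h0, h⟩
    have hlam := lam_pos_of_eigenvalue hε0 hε1 hρ h0 h
    refine ⟨hlam, ?_⟩
    by_contra! hne
    obtain ⟨u, hu0, g, hu, heig⟩ := h
    refine hu0 (ae_eq_zero_of_radialFlux_ne_zero hN hε0 hε1 hρ hlam hu heig fun l => ?_)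
    obtain ⟨S, g₁, g₂, hsys, hiff⟩ := exists_isRadialSystem hN l hε0 hε1 hρ hlam
    exact ⟨S, g₁, g₂, hsys, fun h => hne l (hiff.2 h)⟩
  · rintro ⟨hlam, l, hl⟩
    obtain ⟨S, g₁, g₂, hsys, hiff⟩ := exists_isRadialSystem hN l hε0 hε1 hρ hlam
    exact ⟨hlam.ne', isNeumannEigenvalue_of_radialFlux_eq_zero hN hε1 hsys (hiff.1 hl)⟩
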